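/- Let $N\ge 1$, and let $\mathbf X(t)=(X_i(t))_{i=1}^N$ and $\mathbf Y(t)=(Y_i(t))_{i=1}^N$, $t=1,2,\dots$, be random vectors in $\{0,1\}^N$ such that the pairs $(\mathbf X(t),\mathbf Y(t))$ are i.i.d. over time, with $\alpha_i=\mathbb E[X_i(t)]$ and $\beta_i=\mathbb E[Y_i(t)]$. For each $t$, the components of $\mathbf Y(t)$ are independent, and $X_i(t)$ and $Y_i(t)$ are independent for every $i$; the components of $\mathbf X(t)$ may be dependent. In slot $t$ a learner selects an arm $i(t)\in[N]=\{1,\dots,N\}$, earns the reward $X_{i(t)}(t)\,Y_{i(t)}(t)$, and then observes the whole vector $\mathbf X(t)$ but only the component $Y_{i(t)}(t)$ of $\mathbf Y(t)$. The algorithm AdaPort works as follows. In slot $t$, for each arm $i$ let $\overline\alpha_i(t)=\frac1{t-1}\sum_{\tau=1}^{t-1}X_i(\tau)$ (with $\overline\alpha_i(1)=0$), and let $S_i(t)$ and $F_i(t)$ be the numbers of slots $\tau<t$ with $i(\tau)=i$ in which $Y_i(\tau)=1$ and $Y_i(\tau)=0$, respectively. Given the history of observations, draw $\theta_i(t)\sim\mathrm{Beta}(S_i(t)+1,F_i(t)+1)$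 independently for $i\in[N]$, and select $i(t)\in\arg\max_{i\in[N]}\overline\alpha_i(t)\,\theta_i(t)$, with ties broken arbitrarily. The outcomes $(\mathbf X(t),\mathbf Y(t))$ are independent of the history of observations before slot $t$, the samples $\theta_i(t)$ and the choice $i(t)$, jointly. Let $i^*\in\arg\max_{i\in[N]}\alpha_i\beta_i$, let $\Delta_i=\alpha_{i^*}\beta_{i^*}-\alpha_i\beta_i$, let $$R(T)=\sum_{t=1}^T\mathbb E\left[X_{i^*}(t)Y_{i^*}(t)-X_{i(t)}(t)Y_{i(t)}(t)\right]$$ be the regret of AdaPort, and let $d(p,q)=p\log\frac pq+(1-p)\log\frac{1-p}{1-q}$ be the Kullback-Leibler divergence between the Bernoulli distributions with parameters $p$ and $q$. Then $$\limsup_{T\to\infty}\frac{R(T)}{\log T}\;\le\;\sum_{i\ne i^*\,:\,\alpha_i>\alpha_{i^*}\beta_{i^*}}\frac{\Delta_i}{d\left(\beta_i,\frac{\alpha_{i^*}\beta_{i^*}}{\alpha_i}\right)},$$ where a term with $\Delta_i=0$ (another optimal arm) is read as $0$. -/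

import Mathlib

open MeasureTheory ProbabilityTheory Filter

noncomputable section

namespace AdaPort

/-- The numerical value (`1` or `0`) of a binary outcome. -/
def bit (b : Bool) : ℝ := if b then 1 else 0

/-- The Kullback-Leibler divergence between the Bernoulli laws with parameters `p` and `q`
(with `0 log 0 = 0`). -/
def bernoulliKL (p q : ℝ) : ℝ :=
  p * Real.log (p / q) + (1 - p) * Real.log ((1 - p) / (1 - q))

/-- What the learner observes in one time slot: the prediction outcomes of all the portions
(full information), the portion played, and the transmission outcome of that portion only
(bandit feedback), in this order. -/
abbrev Obs (N : ℕ) : Type := (Fin N → Bool) × Fin N × Bool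

/-- The history of observations available at the beginning of slot `t`. Slots are numbered
`0, 1, 2, …`, so it consists of the observations of the `t` slots `0, …, t - 1`. -/
abbrev History (N t : ℕ) : Type := Fin t → Obs N

/-- The empirical mean of the prediction outcomes of portion `i` (it is `0` in the first slot). -/
def empMean {N t : ℕ} (h : History N t) (i : Fin N) : ℝ :=
  (∑ τ, bit ((h τ).1 i)) / t

/-- The number of observed transmission successes of portion `i`. -/
def succCount {N t : ℕ} (h : History N t) (i : Fin N) : ℕ :=
  ∑ τ, if (h τ).2.1 = i ∧ (h τ).2.2 = true then 1 else 0

/-- The number of observed transmission failures of portion `i`. -/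
def failCount {N t : ℕ} (h : History N t) (i : Fin N) : ℕ :=
  ∑ τ, if (h τ).2.1 = i ∧ (h τ).2.2 = false then 1 else 0

/-- The joint posterior of the transmission rates given the history: independent over the
portions, with law `Beta (successes + 1, failures + 1)` for each of them. -/
def betaPosterior {N t : ℕ} (h : History N t) : Measure (Fin N → ℝ) :=
  Measure.pi fun i => betaMeasure (succCount h i + 1) (failCount h i + 1)

variable {Ω : Type*}

/-- The observed history at the beginning of slot `t`, when `X`, `Y` are the prediction and
transmission outcomes and `arm s` is the portion played in slot `s`. -/
def history {N : ℕ} (X Y : ℕ → Ω → Fin N → Bool) (arm : ℕ → Ω → Fin N) (t : ℕ) (ω : Ω) :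
    History N t :=
  fun τ => (X τ ω, arm τ ω, Y τ ω (arm τ ω))

variable [MeasurableSpace Ω]

/-- `X t ω i` and `Y t ω i` are the prediction and transmission outcomes of portion `i` in slot
`t`. The pairs of outcome vectors are i.i.d. over time, `X t · i` has mean `α i`, `Y t · i` has
mean `β i`, the transmission outcomes of different portions are independent, and so are the
prediction and the transmission outcome of the same portion. The prediction outcomes of different
portions may be dependent. -/
structure IsEnvironment {N : ℕ} (P : Measure Ω) (α β : Fin N → ℝ)
    (X Y : ℕ → Ω → Fin N → Bool) : Prop where
  measurable_X : ∀ t, Measurable (X t)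
  measurable_Y : ∀ t, Measurable (Y t)
  indep_time : iIndepFun (fun t ω => (X t ω, Y t ω)) P
  identDistrib : ∀ t, IdentDistrib (fun ω => (X t ω, Y t ω)) (fun ω => (X 0 ω, Y 0 ω)) P P
  mean_X : ∀ t i, ∫ ω, bit (X t ω i) ∂P = α i
  mean_Y : ∀ t i, ∫ ω, bit (Y t ω i) ∂P = β i
  indep_Y : ∀ t, iIndepFun (fun i ω => Y t ω i) P
  indep_XY : ∀ t i, IndepFun (fun ω => X t ω i) (fun ω => Y t ω i) P

/-- `arm` is the sequence of portions played by AdaPort, with Thompson samples `θ`, against the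
outcomes `X`, `Y`. In slot `t`, given the observed history, the samples `θ t` are drawn from the
posterior, and the portion played maximizes (empirical mean) * (Thompson sample), with ties broken
arbitrarily. The current outcomes are independent of the history, the samples and the choice. -/
structure IsAdaPort {N : ℕ} (P : Measure Ω) (X Y : ℕ → Ω → Fin N → Bool)
    (θ : ℕ → Ω → Fin N → ℝ) (arm : ℕ → Ω → Fin N) : Prop where
  measurable_θ : ∀ t, Measurable (θ t)
  measurable_arm : ∀ t, Measurable (arm t)
  sample : ∀ t (h : History N t), P (history X Y arm t ⁻¹' {h}) ≠ 0 →
    (P[|history X Y arm t ⁻¹' {h}]).map (θ t) = betaPosterior h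
  argmax : ∀ t, ∀ᵐ ω ∂P, ∀ j,
    empMean (history X Y arm t ω) j * θ t ω j ≤
      empMean (history X Y arm t ω) (arm t ω) * θ t ω (arm t ω)
  nonanticipating : ∀ t, IndepFun (fun ω => (X t ω, Y t ω))
    (fun ω => (history X Y arm t ω, θ t ω, arm t ω)) P

/-- The reward (throughput) of portion `i` in slot `t`. -/
def reward {N : ℕ} (X Y : ℕ → Ω → Fin N → Bool) (t : ℕ) (ω : Ω) (i : Fin N) : ℝ :=
  bit (X t ω i) * bit (Y t ω i)

/-- The regret after `T` slots with respect to portion `i₀`. -/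
def regret {N : ℕ} (P : Measure Ω) (X Y : ℕ → Ω → Fin N → Bool) (arm : ℕ → Ω → Fin N)
    (i₀ : Fin N) (T : ℕ) : ℝ :=
  ∑ t ∈ Finset.range T, ∫ ω, (reward X Y t ω i₀ - reward X Y t ω (arm t ω)) ∂P

end AdaPort

end

noncomputable section

namespace AdaPort

/-! By independence of the outcomes from the choice, the regret is the sum of the gaps times the
expected numbers of plays, so it is enough to bound the plays of one suboptimal arm `i`. Write `o`
for the optimal arm. Fix `β i < x < y` and `z < β o` with `α i * y < α o * z`, and split the slots
in which `i` is played.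

If the sample of `i` is at most `y` and the empirical means are accurate, a sample of `o` above `z`
would have won. The samples are independent given the history, so such a play is at most as likely
as a play of `o`, times the posterior odds against `θ o > z`. Each play of `o` improves the
posterior, and the expected odds after `k` observations are summable in `k`: this part is bounded.
Inaccurate empirical means are summable by Hoeffding's inequality.

If the sample of `i` exceeds `y`, then `i` has fewer than `L = log T / d(x, y)` observations (about
`L` slots), or its success rate exceeds `x` (summable), or the Chernoff bound for the Beta tail
makes the sample a `1 / T` event. Hence there are at most `log T / d(x, y) + O(1)` plays. Letting
`y` increase to `α o * β o / α i` and `x` decrease to `β i` gives the constant. If `α i < α o * β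
o`, take `y = 1`: no sample exceeds it. If equality holds, `y → 1` makes `d` blow up.

Two devices carry this. A Beta tail is a binomial tail (`betaTail_eq_binomCDF`), which gives all
posterior estimates. And sums over the random play times are dominated by sums over the number of
Bernoulli observations (`sum_integral_arm_le`). -/

/-! ### Beta tails as binomial tails -/

/-- The distribution function at `s` of the binomial law with parameters `n` and `y`. -/
def binomCDF (n s : ℕ) (y : ℝ) : ℝ :=
  ∑ j ∈ Finset.range (s + 1), (n.choose j : ℝ) * y ^ j * (1 - y) ^ (n - j)

/-- The derivative of a Bernstein polynomial is a difference of two consecutive ones of lower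
degree, so the sum telescopes to its last term. -/
theorem hasDerivAt_binomCDF (n s : ℕ) (y : ℝ) :
    HasDerivAt (binomCDF (n + 1) s)
      (-((n + 1) * n.choose s) * (y ^ s * (1 - y) ^ (n - s))) y := by
  have hpoly : ∀ s, Polynomial.derivative
      (∑ j ∈ Finset.range (s + 1), bernsteinPolynomial ℝ (n + 1) j) =
      -((n : Polynomial ℝ) + 1) * bernsteinPolynomial ℝ n s := by
    intro s
    induction s with
    | zero => simp [bernsteinPolynomial.derivative_zero]
    | succ s ih =>
      rw [Finset.sum_range_succ, Polynomial.derivative_add, ih,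
        bernsteinPolynomial.derivative_succ]
      simp only [Nat.add_sub_cancel]
      push_cast
      ring
  have h := (∑ j ∈ Finset.range (s + 1), bernsteinPolynomial ℝ (n + 1) j).hasDerivAt y
  rw [hpoly] at h
  convert! h using 1
  · ext z
    simp [binomCDF, Polynomial.eval_finsetSum, bernsteinPolynomial]
  · simp [bernsteinPolynomial]
    ring

theorem binomCDF_zero (n s : ℕ) : binomCDF n s 0 = 1 := by
  rw [binomCDF, Finset.sum_eq_single 0] <;> simp +contextual

theorem binomCDF_one {n s : ℕ} (h : s < n) : binomCDF n s 1 = 0 := by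
  refine Finset.sum_eq_zero fun j hj => ?_
  have : n - j ≠ 0 := by
    have := Finset.mem_range.1 hj
    omega
  simp [this]

/-- The posterior probability that a rate exceeds `y` after `s` successes and `f` failures. -/
def betaTail (s f : ℕ) (y : ℝ) : ℝ := (betaMeasure (s + 1) (f + 1)).real (Set.Ioi y)

instance isProbabilityMeasure_betaMeasure_succ (s f : ℕ) :
    IsProbabilityMeasure (betaMeasure ((s : ℝ) + 1) ((f : ℝ) + 1)) :=
  isProbabilityMeasureBeta (by positivity) (by positivity)

theorem integral_pow_mul_one_sub_pow (s f : ℕ) (y : ℝ) :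
    ((s + f + 1 : ℝ) * (s + f).choose s) * ∫ x in y..1, x ^ s * (1 - x) ^ f =
      binomCDF (s + f + 1) s y := by
  have h := intervalIntegral.integral_eq_sub_of_hasDerivAt
    (f := binomCDF (s + f + 1) s)
    (f' := fun x => -((((s + f : ℕ) : ℝ) + 1) * (s + f).choose s) *
      (x ^ s * (1 - x) ^ (s + f - s))) (a := y) (b := 1)
    (fun x _ => hasDerivAt_binomCDF (s + f) s x)
    (Continuous.intervalIntegrable (by fun_prop) _ _)
  rw [intervalIntegral.integral_const_mul, binomCDF_one (by omega),
    Nat.add_sub_cancel_left] at h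
  push_cast at h
  linarith

theorem betaTail_eq_integral (s f : ℕ) {y : ℝ} (h0 : 0 ≤ y) (h1 : y ≤ 1) :
    betaTail s f y =
      1 / beta (s + 1) (f + 1) * ∫ x in y..1, x ^ s * (1 - x) ^ f := by
  have hb : 0 < beta ((s : ℝ) + 1) (f + 1) := beta_pos (by positivity) (by positivity)
  have hnn : ∀ x ∈ Set.Ioo y 1, 0 ≤ 1 / beta ((s : ℝ) + 1) (f + 1) * (x ^ s * (1 - x) ^ f) := by
    intro x hx
    have : 0 ≤ 1 - x := by linarith [hx.2]
    have : 0 ≤ x := by linarith [hx.1]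
    positivity
  rw [betaTail, measureReal_def, betaMeasure, withDensity_apply _ measurableSet_Ioi,
    ← intervalIntegral.integral_const_mul, intervalIntegral.integral_of_le h1,
    integral_Ioc_eq_integral_Ioo, integral_eq_lintegral_of_nonneg_ae
      (ae_restrict_of_forall_mem measurableSet_Ioo hnn)
      (Continuous.aestronglyMeasurable (by fun_prop))]
  congr 1
  rw [← lintegral_indicator measurableSet_Ioi, ← lintegral_indicator measurableSet_Ioo]
  congr 1
  ext x
  by_cases hx : x ∈ Set.Ioo y 1
  · rw [Set.indicator_of_mem (show x ∈ Set.Ioi y from hx.1), Set.indicator_of_mem hx,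
      betaPDF_of_pos_lt_one (h0.trans_lt hx.1) hx.2]
    simp [mul_assoc]
  · rw [Set.indicator_of_notMem hx]
    by_cases hy : x ∈ Set.Ioi y
    · rw [Set.indicator_of_mem hy]
      exact betaPDF_eq_zero_of_one_le (not_lt.1 fun h => hx ⟨hy, h⟩)
    · rw [Set.indicator_of_notMem hy]

theorem betaTail_zero (s f : ℕ) : betaTail s f 0 = 1 := by
  have h : betaMeasure ((s : ℝ) + 1) (f + 1) (Set.Iic 0) = 0 := by
    rw [betaMeasure, withDensity_apply _ measurableSet_Iic]
    exact setLIntegral_eq_zero measurableSet_Iic fun x hx => betaPDF_eq_zero_of_nonpos hx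
  rw [betaTail, ← Set.compl_Iic, probReal_compl_eq_one_sub measurableSet_Iic, measureReal_def, h]
  simp

/-- The upper tail of a Beta law is a lower tail of a binomial law. -/
theorem betaTail_eq_binomCDF (s f : ℕ) {y : ℝ} (h0 : 0 ≤ y) (h1 : y ≤ 1) :
    betaTail s f y = binomCDF (s + f + 1) s y := by
  have hc : (0 : ℝ) < (s + f + 1 : ℝ) * (s + f).choose s := by
    have : 0 < (s + f).choose s := Nat.choose_pos (by omega)
    positivity
  have e0 := betaTail_eq_integral s f le_rfl zero_le_one
  have i0 := integral_pow_mul_one_sub_pow s f 0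
  rw [betaTail_zero] at e0
  rw [binomCDF_zero] at i0
  -- At `y = 0` both tails equal `1`, so the two normalizing constants agree and the Beta function
  -- need not be evaluated.
  have key : 1 / beta ((s : ℝ) + 1) (f + 1) = (s + f + 1 : ℝ) * (s + f).choose s := by
    have hI : (∫ x in (0 : ℝ)..1, x ^ s * (1 - x) ^ f) ≠ 0 := by
      intro h
      simp [h] at e0
    exact mul_right_cancel₀ hI (e0.symm.trans i0.symm)
  rw [betaTail_eq_integral s f h0 h1, key, integral_pow_mul_one_sub_pow]

/-- Only the top term `j = s` is kept. The coefficient is lowered to `(s + f).choose s` so that it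
cancels against the binomial weight of the counts `(s, f)` when the inverse tail is averaged. -/
theorem choose_mul_le_betaTail (s f : ℕ) {y : ℝ} (h0 : 0 ≤ y) (h1 : y ≤ 1) :
    ((s + f).choose s : ℝ) * y ^ s * (1 - y) ^ (f + 1) ≤ betaTail s f y := by
  have h2 : 0 ≤ 1 - y := by linarith
  rw [betaTail_eq_binomCDF s f h0 h1, binomCDF]
  refine le_trans ?_ (Finset.single_le_sum (fun j _ => by positivity)
    (Finset.self_mem_range_succ s))
  rw [show s + f + 1 - s = f + 1 by omega]
  have : (s + f).choose s ≤ (s + f + 1).choose s := Nat.choose_le_choose s (by omega)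
  gcongr

theorem betaTail_pos (s f : ℕ) {y : ℝ} (h0 : 0 < y) (h1 : y < 1) : 0 < betaTail s f y := by
  refine lt_of_lt_of_le ?_ (choose_mul_le_betaTail s f h0.le h1.le)
  have h2 : 0 < 1 - y := by linarith
  have : 0 < (s + f).choose s := Nat.choose_pos (by omega)
  positivity

theorem betaTail_le_one (s f : ℕ) (y : ℝ) : betaTail s f y ≤ 1 := measureReal_le_one

/-! ### Chernoff bounds for Beta tails -/

theorem sum_binomial_mul_pow (n : ℕ) (y l : ℝ) :
    ∑ j ∈ Finset.range (n + 1), (n.choose j : ℝ) * y ^ j * (1 - y) ^ (n - j) * l ^ j =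
      (1 - y + l * y) ^ n := by
  rw [add_comm (1 - y), add_pow]
  refine Finset.sum_congr rfl fun j _ => ?_
  rw [mul_pow]
  ring

/-- The exponential Markov inequality for the lower tail. -/
theorem betaTail_le (s f : ℕ) {y l : ℝ} (h0 : 0 ≤ y) (h1 : y ≤ 1) (hl0 : 0 < l) (hl1 : l ≤ 1) :
    betaTail s f y * l ^ s ≤ (1 - y + l * y) ^ (s + f + 1) := by
  have h2 : 0 ≤ 1 - y := by linarith
  rw [betaTail_eq_binomCDF s f h0 h1, ← sum_binomial_mul_pow, binomCDF, Finset.sum_mul]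
  refine le_trans (Finset.sum_le_sum fun j hj => ?_) (Finset.sum_le_sum_of_subset_of_nonneg
    (Finset.range_mono (show s + 1 ≤ s + f + 1 + 1 by omega)) fun j _ _ => by positivity)
  have : l ^ s ≤ l ^ j := pow_le_pow_of_le_one hl0.le hl1 (by
    have := Finset.mem_range.1 hj
    omega)
  gcongr

/-- The exponential Markov inequality for the upper tail. -/
theorem one_sub_betaTail_le (s f : ℕ) {y l : ℝ} (h0 : 0 ≤ y) (h1 : y ≤ 1) (hl : 1 ≤ l) :
    (1 - betaTail s f y) * l ^ s ≤ (1 - y + l * y) ^ (s + f + 1) := by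
  have h2 : 0 ≤ 1 - y := by linarith
  have hl0 : 0 ≤ l := by linarith
  have hsum : binomCDF (s + f + 1) s y + ∑ j ∈ Finset.Ico (s + 1) (s + f + 1 + 1),
      ((s + f + 1).choose j : ℝ) * y ^ j * (1 - y) ^ (s + f + 1 - j) = 1 := by
    rw [binomCDF, Finset.sum_range_add_sum_Ico _ (by omega)]
    simpa using sum_binomial_mul_pow (s + f + 1) y 1
  rw [betaTail_eq_binomCDF s f h0 h1, ← eq_sub_of_add_eq' hsum, ← sum_binomial_mul_pow,
    Finset.sum_mul]
  refine le_trans (Finset.sum_le_sum fun j hj => ?_) (Finset.sum_le_sum_of_subset_of_nonneg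
    (s := Finset.Ico (s + 1) (s + f + 1 + 1)) (fun j hj => ?_) fun j _ _ => by positivity)
  · have : l ^ s ≤ l ^ j := pow_le_pow_right₀ hl (by
      have := Finset.mem_Ico.1 hj
      omega)
    gcongr
  · have := Finset.mem_Ico.1 hj
    exact Finset.mem_range.2 this.2

theorem bernoulliKL_eq {x y : ℝ} (hx0 : 0 < x) (hx1 : x < 1) (hy0 : 0 < y) (hy1 : y < 1) :
    bernoulliKL x y = x * Real.log (x * (1 - y) / (y * (1 - x))) -
      Real.log ((1 - y) / (1 - x)) := by
  have h1 : 0 < 1 - x := by linarith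
  have h2 : 0 < 1 - y := by linarith
  rw [bernoulliKL, Real.log_div hx0.ne' hy0.ne', Real.log_div h1.ne' h2.ne',
    Real.log_div (by positivity) (by positivity), Real.log_mul hx0.ne' h2.ne',
    Real.log_mul hy0.ne' h1.ne', Real.log_div h2.ne' h1.ne']
  ring

/-- The Chernoff bound. -/
theorem betaTail_le_exp_neg_bernoulliKL {s f : ℕ} {x y : ℝ} (hx0 : 0 < x) (hxy : x < y)
    (hy1 : y < 1) (hs : s ≤ x * (s + f)) :
    betaTail s f y ≤ Real.exp (-((s + f) * bernoulliKL x y)) := by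
  have hy0 : 0 < y := hx0.trans hxy
  have h1 : 0 < 1 - x := by linarith
  have h2 : 0 < 1 - y := by linarith
  -- The optimal tilt: weighting a success by `l` turns the Bernoulli law of parameter `y` into that
  -- of parameter `x`.
  set l := x * (1 - y) / (y * (1 - x)) with hl
  have hl0 : 0 < l := by positivity
  have hl1 : l ≤ 1 := by
    rw [hl, div_le_one (by positivity)]
    nlinarith
  have hr : 1 - y + l * y = (1 - y) / (1 - x) := by
    rw [hl]
    field_simp
    ring
  have hr1 : (1 - y) / (1 - x) ≤ 1 := by
    rw [div_le_one h1]
    linarith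
  have h := betaTail_le s f hy0.le hy1.le hl0 hl1
  rw [hr] at h
  -- The extra trial in `s + f + 1` is dropped, since the base is at most `1`.
  have h' : betaTail s f y * l ^ s ≤ ((1 - y) / (1 - x)) ^ (s + f) :=
    h.trans (pow_le_pow_of_le_one (by positivity) hr1 (by omega))
  rw [← le_div_iff₀ (by positivity)] at h'
  refine h'.trans ?_
  have e1 : ∀ (a : ℝ) (n : ℕ), 0 < a → a ^ n = Real.exp (n * Real.log a) := fun a n ha => by
    rw [Real.exp_nat_mul, Real.exp_log ha]
  rw [e1 _ _ (by positivity), e1 _ _ hl0, ← Real.exp_sub, Real.exp_le_exp,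
    bernoulliKL_eq hx0 (hxy.trans hy1) hy0 hy1, ← hl]
  have := mul_le_mul_of_nonpos_right hs (Real.log_nonpos hl0.le hl1)
  push_cast
  linarith

/-- This makes exponential Markov work: `exp (y * (exp u - 1) - u * m) < 1` bounds the exponential
moment of one observation of mean `y`, centred at `m`. Since `exp u - 1 ≤ u / (1 - u)`, it suffices
that `y < m * (1 - u)`, which holds for `u = (m - y) / 2` because `m ≤ 1`. -/
theorem exists_exp_rate {y m : ℝ} (h0 : 0 ≤ y) (hym : y < m) (hm : m ≤ 1) :
    ∃ u > 0, y * (Real.exp u - 1) < u * m := by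
  refine ⟨(m - y) / 2, by linarith, ?_⟩
  set u := (m - y) / 2 with hu
  have hu0 : 0 < u := by linarith
  have hu1 : 0 < 1 - u := by linarith
  have h1 : Real.exp u * (1 - u) ≤ 1 := by
    have := Real.one_sub_le_exp_neg u
    calc Real.exp u * (1 - u) ≤ Real.exp u * Real.exp (-u) := by gcongr
      _ = 1 := by rw [← Real.exp_add]; simp
  have h2 : (Real.exp u - 1) * (1 - u) ≤ u := by linarith
  have h3 : y < m * (1 - u) := by nlinarith
  refine lt_of_mul_lt_mul_right ?_ hu1.le
  nlinarith

/-- Exponential Markov with the tilt of `exists_exp_rate`; the constant `C` absorbs the extra trial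
in `s + f + 1`. -/
theorem exists_one_sub_betaTail_le {y m : ℝ} (h0 : 0 ≤ y) (hym : y < m) (hm : m ≤ 1) :
    ∃ C r : ℝ, 0 ≤ C ∧ 0 < r ∧ r < 1 ∧ ∀ s f : ℕ, m * (s + f) ≤ s →
      1 - betaTail s f y ≤ C * r ^ (s + f) := by
  obtain ⟨u, hu, hr⟩ := exists_exp_rate h0 hym hm
  refine ⟨Real.exp (y * (Real.exp u - 1)), Real.exp (y * (Real.exp u - 1) - u * m),
    by positivity, by positivity, Real.exp_lt_one_iff.2 (by linarith), fun s f hs => ?_⟩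
  have h := one_sub_betaTail_le s f h0 (hym.le.trans hm) (Real.one_le_exp hu.le)
  have h1 : 1 - y + Real.exp u * y ≤ Real.exp (y * (Real.exp u - 1)) := by
    have := Real.add_one_le_exp (y * (Real.exp u - 1))
    linarith
  have h2 : 0 ≤ 1 - y + Real.exp u * y := by
    have := Real.exp_pos u
    nlinarith
  have h3 := h.trans (pow_le_pow_left₀ h2 h1 _)
  rw [← Real.exp_nat_mul, ← le_div_iff₀ (by positivity), ← Real.exp_nat_mul, ← Real.exp_sub] at h3
  refine h3.trans ?_
  rw [← Real.exp_nat_mul, ← Real.exp_add, Real.exp_le_exp]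
  push_cast
  nlinarith

/-! ### Averages over Bernoulli observations -/

/-- One Bernoulli observation with success probability `b`, acting on functions of the numbers of
successes and failures. -/
def step (b : ℝ) (g : ℕ → ℕ → ℝ) : ℕ → ℕ → ℝ :=
  fun s f => b * g (s + 1) f + (1 - b) * g s (f + 1)

/-- Pascal's rule shows that iterating `step` from zero counts is the expectation over `k`
independent observations. -/
theorem step_iterate_zero_zero (b : ℝ) (k : ℕ) (g : ℕ → ℕ → ℝ) :
    (step b)^[k] g 0 0 = ∑ p ∈ Finset.HasAntidiagonal.antidiagonal k,
      (k.choose p.1 : ℝ) * (b ^ p.1 * (1 - b) ^ p.2 * g p.1 p.2) := by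
  induction k generalizing g with
  | zero => simp
  | succ k ih =>
    have h := Finset.sum_antidiagonal_choose_succ_mul
      (fun i j => b ^ i * (1 - b) ^ j * g i j) k
    rw [h, Function.iterate_succ_apply, ih, ← Finset.sum_add_distrib]
    refine Finset.sum_congr rfl fun p hp => ?_
    have hk : k.choose p.1 = k.choose p.2 := by
      rw [← Finset.HasAntidiagonal.mem_antidiagonal.1 hp]
      exact Nat.choose_symm_add
    rw [← hk, step]
    ring

theorem step_iterate_nonneg {b : ℝ} (h0 : 0 ≤ b) (h1 : b ≤ 1) {g : ℕ → ℕ → ℝ}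
    (hg : ∀ s f, 0 ≤ g s f) (k s f : ℕ) : 0 ≤ (step b)^[k] g s f := by
  induction k generalizing g with
  | zero => exact hg s f
  | succ k ih =>
    rw [Function.iterate_succ_apply]
    have h2 : 0 ≤ 1 - b := by linarith
    exact ih fun s f => add_nonneg (mul_nonneg h0 (hg _ _)) (mul_nonneg h2 (hg _ _))

theorem sum_binomial_antidiagonal (b : ℝ) (k : ℕ) :
    ∑ p ∈ Finset.HasAntidiagonal.antidiagonal k,
      (k.choose p.1 : ℝ) * (b ^ p.1 * (1 - b) ^ p.2) = 1 := by
  have h := (Commute.all b (1 - b)).add_pow' k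
  simpa using h.symm

/-- Upper deviations of the empirical success rate are summable. -/
theorem summable_step_iterate_indicator {b x : ℝ} (h0 : 0 ≤ b) (hbx : b < x) (hx : x ≤ 1) :
    Summable fun k => (step b)^[k] (fun s f => if x * (s + f) < s then 1 else 0) 0 0 := by
  obtain ⟨u, hu, hr⟩ := exists_exp_rate h0 hbx hx
  have h1 : 0 ≤ 1 - b := by linarith
  refine Summable.of_nonneg_of_le
    (fun k => step_iterate_nonneg h0 (hbx.le.trans hx) (fun s f => by split_ifs <;> norm_num) k 0 0)
    (fun k => ?_) (summable_geometric_of_lt_one (Real.exp_pos (b * (Real.exp u - 1) - u * x)).le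
      (Real.exp_lt_one_iff.2 (by linarith)))
  rw [step_iterate_zero_zero]
  calc ∑ p ∈ Finset.HasAntidiagonal.antidiagonal k, (k.choose p.1 : ℝ) *
        (b ^ p.1 * (1 - b) ^ p.2 * if x * (p.1 + p.2) < (p.1 : ℝ) then 1 else 0)
      ≤ ∑ p ∈ Finset.HasAntidiagonal.antidiagonal k, (k.choose p.1 : ℝ) *
        (b ^ p.1 * (1 - b) ^ p.2 * (Real.exp u ^ p.1 * Real.exp (-(k * (u * x))))) := by
        refine Finset.sum_le_sum fun p hp => ?_
        have hk : (p.1 : ℝ) + p.2 = k := by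
          exact_mod_cast Finset.HasAntidiagonal.mem_antidiagonal.1 hp
        gcongr
        rw [← Real.exp_nat_mul, ← Real.exp_add]
        split_ifs with h
        · rw [hk] at h
          exact Real.one_le_exp (by nlinarith)
        · positivity
    _ = (b * Real.exp u + (1 - b)) ^ k * Real.exp (-(k * (u * x))) := by
        rw [(Commute.all (b * Real.exp u) (1 - b)).add_pow' k, Finset.sum_mul]
        refine Finset.sum_congr rfl fun p _ => ?_
        rw [mul_pow, nsmul_eq_mul]
        ring
    _ ≤ Real.exp (b * (Real.exp u - 1)) ^ k * Real.exp (-(k * (u * x))) := by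
        have := Real.exp_pos u
        have := Real.add_one_le_exp (b * (Real.exp u - 1))
        gcongr
        linarith
    _ = Real.exp (b * (Real.exp u - 1) - u * x) ^ k := by
        rw [← Real.exp_nat_mul, ← Real.exp_nat_mul, ← Real.exp_add]
        ring_nf

/-- A change of parameter from `b` to `z < b` costs an exponential factor on the event that the
success rate is at most some `m > z`. -/
theorem exists_change_of_parameter {z b : ℝ} (hz : 0 < z) (hzb : z < b) (hb : b ≤ 1) :
    ∃ m r : ℝ, z < m ∧ m ≤ 1 ∧ 0 < r ∧ r < 1 ∧ ∀ s f : ℕ, (s : ℝ) ≤ m * (s + f) →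
      (b / z) ^ s * ((1 - b) / (1 - z)) ^ f ≤ r ^ (s + f) := by
  have hz1 : 0 < 1 - z := by linarith
  have ha : 1 < b / z := (one_lt_div hz).2 hzb
  have hla : 0 < Real.log (b / z) := Real.log_pos ha
  -- The drift at success rate `z` is minus the divergence of `z` from `b`, hence negative. For `b =
  -- 1` the failure ratio is `0` and its logarithm is a default value, so the ratio is replaced by a
  -- positive `c` that makes the drift `-1`.
  obtain ⟨c, hc0, hc, hcl⟩ : ∃ c : ℝ, 0 < c ∧ (1 - b) / (1 - z) ≤ c ∧
      z * Real.log (b / z) + (1 - z) * Real.log c < 0 := by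
    rcases hb.lt_or_eq with hb | rfl
    · have hb1 : 0 < 1 - b := by linarith
      refine ⟨(1 - b) / (1 - z), by positivity, le_rfl, ?_⟩
      have h1 : Real.log (b / z) < b / z - 1 := Real.log_lt_sub_one_of_pos (by positivity) ha.ne'
      have h2 : Real.log ((1 - b) / (1 - z)) ≤ (1 - b) / (1 - z) - 1 :=
        Real.log_le_sub_one_of_pos (by positivity)
      have e1 : z * (b / z - 1) + (1 - z) * ((1 - b) / (1 - z) - 1) = 0 := by
        field_simp
        ring
      nlinarith
    · refine ⟨Real.exp (-(z * Real.log (1 / z) + 1) / (1 - z)), by positivity, ?_, ?_⟩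
      · simpa using Real.exp_nonneg _
      · rw [Real.log_exp, mul_div_cancel₀ _ hz1.ne']
        linarith
  have hlc : Real.log c < 0 := by nlinarith
  set B := Real.log (b / z) - Real.log c with hB
  have hB0 : 0 < B := by linarith
  set A := -(z * Real.log (b / z) + (1 - z) * Real.log c) with hA
  have hA0 : 0 < A := by linarith
  -- The exponent `log c + m * B` equals `-A` at `m = z` and has slope `B`, so moving by at most `A
  -- / (2 * B)` keeps it below `-A / 2`; the cap `1 - z` ensures `m ≤ 1`.
  set m := z + min (A / (2 * B)) (1 - z) with hm
  have hm1 : 0 < min (A / (2 * B)) (1 - z) := lt_min (by positivity) hz1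
  refine ⟨m, Real.exp (Real.log c + m * B), by linarith,
    by linarith [min_le_right (A / (2 * B)) (1 - z)], by positivity, Real.exp_lt_one_iff.2 ?_, ?_⟩
  · have h1 : min (A / (2 * B)) (1 - z) * B ≤ A / (2 * B) * B :=
      mul_le_mul_of_nonneg_right (min_le_left _ _) hB0.le
    have h2 : A / (2 * B) * B = A / 2 := by field_simp
    have h3 : m * B = z * B + min (A / (2 * B)) (1 - z) * B := by rw [hm]; ring
    rw [h3]
    have h4 : z * B = z * Real.log (b / z) - z * Real.log c := by rw [hB]; ring
    linarith
  · intro s f hs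
    have h0 : 0 ≤ (1 - b) / (1 - z) := div_nonneg (by linarith) hz1.le
    have ha0 : 0 < b / z := by linarith
    calc (b / z) ^ s * ((1 - b) / (1 - z)) ^ f ≤ (b / z) ^ s * c ^ f := by gcongr
      _ = Real.exp (s * Real.log (b / z) + f * Real.log c) := by
        rw [Real.exp_add, Real.exp_nat_mul, Real.exp_nat_mul, Real.exp_log ha0, Real.exp_log hc0]
      _ ≤ Real.exp ((s + f : ℕ) * (Real.log c + m * B)) := by
        rw [Real.exp_le_exp]
        have := mul_le_mul_of_nonneg_right hs hB0.le
        push_cast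
        rw [hB] at this ⊢
        linarith
      _ = _ := Real.exp_nat_mul _ _

/-- The expected inverse posterior probability of exceeding `z < b` tends to `1` at a summable
rate. -/
theorem summable_step_iterate_inv_betaTail {z b : ℝ} (hz : 0 < z) (hzb : z < b) (hb : b ≤ 1) :
    Summable fun k => (step b)^[k] (fun s f => (betaTail s f z)⁻¹ - 1) 0 0 := by
  obtain ⟨m, r, hzm, hm1, hr0, hr1, hlow⟩ := exists_change_of_parameter hz hzb hb
  obtain ⟨C, q, hC, hq0, hq1, hup⟩ := exists_one_sub_betaTail_le hz.le hzm hm1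
  have hz1 : 0 < 1 - z := by linarith
  have hb0 : 0 < b := hz.trans hzb
  have hb1 : 0 ≤ 1 - b := by linarith
  have hpos := fun s f => betaTail_pos s f hz (hzb.trans_le hb)
  have hnn : ∀ s f, 0 ≤ (betaTail s f z)⁻¹ - 1 := fun s f => by
    linarith [(one_le_inv₀ (hpos s f)).2 (betaTail_le_one s f z)]
  have hsum : Summable fun k : ℕ => (1 - z)⁻¹ * ((k + 1) * r ^ k) + 2 * C * q ^ k := by
    refine Summable.add (Summable.mul_left _ ?_)
      ((summable_geometric_of_lt_one hq0.le hq1).mul_left _)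
    have h1 : Summable fun k : ℕ => ((k : ℝ) ^ 1 * r ^ k) :=
      summable_pow_mul_geometric_of_norm_lt_one 1 (by rwa [Real.norm_of_nonneg hr0.le])
    refine (h1.add (summable_geometric_of_lt_one hr0.le hr1)).congr fun k => ?_
    ring
  refine Summable.of_norm_bounded_eventually_nat hsum ?_
  have hev : ∀ᶠ k : ℕ in atTop, C * q ^ k < 1 / 2 := by
    have := (tendsto_pow_atTop_nhds_zero_of_lt_one hq0.le hq1).const_mul C
    rw [mul_zero] at this
    exact this.eventually_lt_const (by norm_num)
  filter_upwards [hev] with k hk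
  rw [Real.norm_of_nonneg (step_iterate_nonneg hb0.le hb hnn k 0 0), step_iterate_zero_zero]
  -- At success rates below `m`, weight times inverse tail is at most a likelihood ratio, hence
  -- geometric, and there are only `k + 1` pairs. Above `m`, the tail is at least `1 / 2` by `hev`,
  -- and the odds are geometrically small.
  have hterm : ∀ p ∈ Finset.HasAntidiagonal.antidiagonal k, (k.choose p.1 : ℝ) *
      (b ^ p.1 * (1 - b) ^ p.2 * ((betaTail p.1 p.2 z)⁻¹ - 1)) ≤
      (1 - z)⁻¹ * r ^ k + (k.choose p.1 : ℝ) * (b ^ p.1 * (1 - b) ^ p.2) * (2 * C * q ^ k) := by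
    rintro ⟨s, f⟩ hp
    obtain rfl : s + f = k := Finset.HasAntidiagonal.mem_antidiagonal.1 hp
    dsimp only
    rcases le_total (s : ℝ) (m * (s + f)) with h | h
    · refine le_trans ?_ (le_add_of_nonneg_right (by positivity))
      have hc : (0 : ℝ) < (s + f).choose s := by
        exact_mod_cast Nat.choose_pos (by omega)
      have h1 := choose_mul_le_betaTail s f hz.le (hzb.le.trans hb)
      have h2 : (betaTail s f z)⁻¹ ≤ (((s + f).choose s : ℝ) * z ^ s * (1 - z) ^ (f + 1))⁻¹ :=
        inv_anti₀ (by positivity) h1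
      calc ((s + f).choose s : ℝ) * (b ^ s * (1 - b) ^ f * ((betaTail s f z)⁻¹ - 1))
          ≤ ((s + f).choose s : ℝ) * (b ^ s * (1 - b) ^ f *
            (((s + f).choose s : ℝ) * z ^ s * (1 - z) ^ (f + 1))⁻¹) := by
            gcongr
            linarith
        _ = (1 - z)⁻¹ * ((b / z) ^ s * ((1 - b) / (1 - z)) ^ f) := by
            rw [div_pow, div_pow, pow_succ]
            field_simp
        _ ≤ (1 - z)⁻¹ * r ^ (s + f) := by
            gcongr
            exact hlow s f h
    · refine le_trans ?_ (le_add_of_nonneg_left (by positivity))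
      rw [← mul_assoc]
      refine mul_le_mul_of_nonneg_left ?_ (by positivity)
      have h1 := hup s f h
      have h2 : 1 / 2 ≤ betaTail s f z := by linarith
      have h3 := hpos s f
      rw [show (betaTail s f z)⁻¹ - 1 = (1 - betaTail s f z) / betaTail s f z by field_simp,
        div_le_iff₀ h3]
      have : 0 ≤ C * q ^ (s + f) := by positivity
      nlinarith
  refine (Finset.sum_le_sum hterm).trans (le_of_eq ?_)
  rw [Finset.sum_add_distrib, Finset.sum_const, ← Finset.sum_mul, sum_binomial_antidiagonal,
    Finset.Nat.card_antidiagonal, nsmul_eq_mul]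
  push_cast
  ring

/-! ### Counts and empirical means along the play -/

theorem succCount_history_succ {Ω : Type*} {N : ℕ}
    (X Y : ℕ → Ω → Fin N → Bool) (arm : ℕ → Ω → Fin N) (t : ℕ) (ω : Ω) (i : Fin N) :
    succCount (history X Y arm (t + 1) ω) i =
      succCount (history X Y arm t ω) i +
        if arm t ω = i ∧ Y t ω (arm t ω) = true then 1 else 0 := by
  simp only [succCount, Fin.sum_univ_castSucc]
  rfl

theorem failCount_history_succ {Ω : Type*} {N : ℕ}
    (X Y : ℕ → Ω → Fin N → Bool) (arm : ℕ → Ω → Fin N) (t : ℕ) (ω : Ω) (i : Fin N) :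
    failCount (history X Y arm (t + 1) ω) i =
      failCount (history X Y arm t ω) i +
        if arm t ω = i ∧ Y t ω (arm t ω) = false then 1 else 0 := by
  simp only [failCount, Fin.sum_univ_castSucc]
  rfl

variable {Ω : Type*} [MeasurableSpace Ω] {P : Measure Ω} {N : ℕ} {α β : Fin N → ℝ}
  {X Y : ℕ → Ω → Fin N → Bool} {θ : ℕ → Ω → Fin N → ℝ} {arm : ℕ → Ω → Fin N}

theorem bit_nonneg (b : Bool) : 0 ≤ bit b := by cases b <;> simp [bit]

theorem bit_le_one (b : Bool) : bit b ≤ 1 := by cases b <;> simp [bit]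

theorem empMean_nonneg {t : ℕ} (h : History N t) (i : Fin N) : 0 ≤ empMean h i :=
  div_nonneg (Finset.sum_nonneg fun _ _ => bit_nonneg _) (Nat.cast_nonneg _)

theorem integrable_comp_of_finite {D : Type*} [Finite D] [MeasurableSpace D]
    [MeasurableSingletonClass D] [IsFiniteMeasure P] {Z : Ω → D} (hZ : Measurable Z) (g : D → ℝ) :
    Integrable (fun ω => g (Z ω)) P :=
  (Integrable.of_finite (μ := P.map Z) (f := g)).comp_measurable hZ

theorem measurable_history (henv : IsEnvironment P α β X Y) (halg : IsAdaPort P X Y θ arm)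
    (t : ℕ) : Measurable (history X Y arm t) := by
  refine measurable_pi_lambda _ fun τ => (henv.measurable_X τ).prodMk
    ((halg.measurable_arm τ).prodMk ?_)
  exact (Measurable.of_discrete (f := fun p : (Fin N → Bool) × Fin N => p.1 p.2)).comp
    ((henv.measurable_Y τ).prodMk (halg.measurable_arm τ))

theorem measurable_history_arm (henv : IsEnvironment P α β X Y) (halg : IsAdaPort P X Y θ arm)
    (t : ℕ) : Measurable fun ω => (history X Y arm t ω, arm t ω) :=
  (measurable_history henv halg t).prodMk (halg.measurable_arm t)

/-- The outcomes of slot `t` are independent of the history and of the choice of the arm. -/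
theorem integral_outcome_mul (henv : IsEnvironment P α β X Y) (halg : IsAdaPort P X Y θ arm)
    (t : ℕ) (u : (Fin N → Bool) × (Fin N → Bool) → ℝ) (w : History N t × Fin N → ℝ) :
    ∫ ω, u (X t ω, Y t ω) * w (history X Y arm t ω, arm t ω) ∂P =
      (∫ ω, u (X t ω, Y t ω) ∂P) * ∫ ω, w (history X Y arm t ω, arm t ω) ∂P := by
  have hind : IndepFun (fun ω => u (X t ω, Y t ω))
      (fun ω => w (history X Y arm t ω, arm t ω)) P :=
    (halg.nonanticipating t).comp (φ := u)
      (ψ := fun p : History N t × (Fin N → ℝ) × Fin N => w (p.1, p.2.2))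
      Measurable.of_discrete ((Measurable.of_discrete (f := w)).comp (by fun_prop))
  exact hind.integral_fun_mul_eq_mul_integral
    ((Measurable.of_discrete (f := u)).comp
      ((henv.measurable_X t).prodMk (henv.measurable_Y t))).aestronglyMeasurable
    ((Measurable.of_discrete (f := w)).comp
      (measurable_history_arm henv halg t)).aestronglyMeasurable

/-- The counts of arm `i` make a Bernoulli step exactly in the slots in which it is played. -/
theorem integral_counts_succ [IsProbabilityMeasure P] (henv : IsEnvironment P α β X Y)
    (halg : IsAdaPort P X Y θ arm) (t : ℕ) (i : Fin N) (g : ℕ → ℕ → ℝ) :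
    ∫ ω, g (succCount (history X Y arm (t + 1) ω) i)
        (failCount (history X Y arm (t + 1) ω) i) ∂P =
      ∫ ω, (if arm t ω = i then step (β i) g else g) (succCount (history X Y arm t ω) i)
        (failCount (history X Y arm t ω) i) ∂P := by
  -- The next value of `g` is `a` on a success of arm `i`, `b` on a failure and `c` if `i` is not
  -- played; all three depend only on the past and the choice, hence are independent of the new
  -- outcome.
  let a : History N t × Fin N → ℝ := fun p =>
    if p.2 = i then g (succCount p.1 i + 1) (failCount p.1 i) else 0
  let b : History N t × Fin N → ℝ := fun p =>
    if p.2 = i then g (succCount p.1 i) (failCount p.1 i + 1) else 0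
  let c : History N t × Fin N → ℝ := fun p =>
    if p.2 = i then 0 else g (succCount p.1 i) (failCount p.1 i)
  let W : Ω → History N t × Fin N := fun ω => (history X Y arm t ω, arm t ω)
  have hW : Measurable W := measurable_history_arm henv halg t
  have hXY : Measurable fun ω => ((X t ω, Y t ω), W ω) :=
    ((henv.measurable_X t).prodMk (henv.measurable_Y t)).prodMk hW
  have hXYi : ∀ (u : (Fin N → Bool) × (Fin N → Bool) → ℝ) (w : History N t × Fin N → ℝ),
      Integrable (fun ω => u (X t ω, Y t ω) * w (W ω)) P := fun u w =>
    integrable_comp_of_finite hXY fun p => u p.1 * w p.2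
  have hWi : ∀ w : History N t × Fin N → ℝ, Integrable (fun ω => w (W ω)) P := fun w =>
    integrable_comp_of_finite hW w
  have e1 : ∀ ω, g (succCount (history X Y arm (t + 1) ω) i)
      (failCount (history X Y arm (t + 1) ω) i) =
      bit (Y t ω i) * a (W ω) + (1 - bit (Y t ω i)) * b (W ω) + c (W ω) := by
    intro ω
    rw [succCount_history_succ, failCount_history_succ]
    by_cases h : arm t ω = i
    · cases hY : Y t ω i <;> simp [a, b, c, W, h, hY, bit]
    · simp [a, b, c, W, h]
  have e2 : ∀ ω, (if arm t ω = i then step (β i) g else g) (succCount (history X Y arm t ω) i)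
      (failCount (history X Y arm t ω) i) =
      β i * a (W ω) + (1 - β i) * b (W ω) + c (W ω) := by
    intro ω
    by_cases h : arm t ω = i <;> simp [a, b, c, W, h, step]
  have hY1 : ∫ ω, (1 - bit (Y t ω i)) ∂P = 1 - β i := by
    rw [integral_sub (integrable_const _)
      (integrable_comp_of_finite (henv.measurable_Y t) fun y => bit (y i)), henv.mean_Y]
    simp
  have ha := integral_outcome_mul henv halg t (fun p => bit (p.2 i)) a
  have hb := integral_outcome_mul henv halg t (fun p => 1 - bit (p.2 i)) b
  rw [henv.mean_Y] at ha
  rw [hY1] at hb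
  have iA : Integrable (fun ω => bit (Y t ω i) * a (W ω)) P := hXYi (fun p => bit (p.2 i)) a
  have iB : Integrable (fun ω => (1 - bit (Y t ω i)) * b (W ω)) P :=
    hXYi (fun p => 1 - bit (p.2 i)) b
  have iAB : Integrable (fun ω => bit (Y t ω i) * a (W ω) + (1 - bit (Y t ω i)) * b (W ω)) P :=
    iA.add iB
  have jA : Integrable (fun ω => β i * a (W ω)) P := (hWi a).const_mul _
  have jB : Integrable (fun ω => (1 - β i) * b (W ω)) P := (hWi b).const_mul _
  have jAB : Integrable (fun ω => β i * a (W ω) + (1 - β i) * b (W ω)) P := jA.add jB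
  simp_rw [e1, e2]
  rw [integral_add iAB (hWi c), integral_add iA iB, integral_add jAB (hWi c),
    integral_add jA jB, integral_const_mul, integral_const_mul, ← ha, ← hb]

theorem success_rate_mem_Icc [IsProbabilityMeasure P] (henv : IsEnvironment P α β X Y)
    (i : Fin N) : 0 ≤ β i ∧ β i ≤ 1 := by
  rw [← henv.mean_Y 0 i]
  refine ⟨integral_nonneg fun ω => bit_nonneg _, ?_⟩
  calc ∫ ω, bit (Y 0 ω i) ∂P ≤ ∫ _, (1 : ℝ) ∂P :=
        integral_mono (integrable_comp_of_finite (henv.measurable_Y 0) fun y => bit (y i))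
          (integrable_const _) fun ω => bit_le_one _
    _ = 1 := by simp

/-- A nonnegative function of the counts of arm `i`, summed over the slots in which this arm is
played, is at most its sum over all the numbers of Bernoulli observations. -/
theorem sum_integral_arm_le [IsProbabilityMeasure P] (henv : IsEnvironment P α β X Y)
    (halg : IsAdaPort P X Y θ arm) (i : Fin N) {g : ℕ → ℕ → ℝ} (hg : ∀ s f, 0 ≤ g s f) (T : ℕ) :
    ∑ t ∈ Finset.range T, ∫ ω, (if arm t ω = i then g (succCount (history X Y arm t ω) i)
        (failCount (history X Y arm t ω) i) else 0) ∂P ≤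
      ∑ k ∈ Finset.range T, (step (β i))^[k] g 0 0 := by
  obtain ⟨h0, h1⟩ := success_rate_mem_Icc henv i
  -- A potential: the expected total of `g` over `n` observations, starting with the one made at
  -- counts `(s, f)`.
  let V : ℕ → ℕ → ℕ → ℝ := fun n s f => ∑ k ∈ Finset.range n, (step (β i))^[k] g s f
  have hV : ∀ n s f, V (n + 1) s f = g s f + step (β i) (V n) s f := by
    intro n s f
    simp only [V, step, Finset.sum_range_succ', Function.iterate_succ_apply', Finset.mul_sum]
    rw [← Finset.sum_add_distrib, add_comm]
    rfl
  have hVmono : ∀ n s f, V n s f ≤ V (n + 1) s f := fun n s f => by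
    simp only [V, Finset.sum_range_succ]
    linarith [step_iterate_nonneg h0 h1 hg n s f]
  -- A played slot collects `g` and uses one unit of the budget `n + 1`, by `hV`; an unplayed slot
  -- wastes one, which only lowers the potential. No stopping times are needed.
  have key : ∀ u n : ℕ, ∑ t ∈ Finset.range u, ∫ ω, (if arm t ω = i then
        g (succCount (history X Y arm t ω) i) (failCount (history X Y arm t ω) i) else 0) ∂P +
      ∫ ω, V n (succCount (history X Y arm u ω) i) (failCount (history X Y arm u ω) i) ∂P ≤
      V (n + u) 0 0 := by
    intro u
    induction u with
    | zero => intro n; simp [succCount, failCount]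
    | succ u ih =>
      intro n
      rw [Finset.sum_range_succ, integral_counts_succ henv halg, add_assoc,
        show n + (u + 1) = n + 1 + u by ring]
      refine le_trans (add_le_add le_rfl ?_) (ih (n + 1))
      have hi : ∀ w : History N u × Fin N → ℝ,
          Integrable (fun ω => w (history X Y arm u ω, arm u ω)) P := fun w =>
        integrable_comp_of_finite (measurable_history_arm henv halg u) w
      rw [← integral_add
        (hi fun p => if p.2 = i then g (succCount p.1 i) (failCount p.1 i) else 0)
        (hi fun p => (if p.2 = i then step (β i) (V n) else V n)
          (succCount p.1 i) (failCount p.1 i))]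
      refine integral_mono
        (hi fun p => (if p.2 = i then g (succCount p.1 i) (failCount p.1 i) else 0) +
          (if p.2 = i then step (β i) (V n) else V n) (succCount p.1 i) (failCount p.1 i))
        (hi fun p => V (n + 1) (succCount p.1 i) (failCount p.1 i)) fun ω => ?_
      by_cases h : arm u ω = i
      · simp [h, hV]
      · simpa [h] using hVmono _ _ _
  simpa [V] using key T 0

/-- Hoeffding's inequality for the empirical means of the prediction outcomes, in both
directions according to the sign `σ`. -/
theorem summable_empMean_deviation [IsProbabilityMeasure P] (henv : IsEnvironment P α β X Y)
    (arm : ℕ → Ω → Fin N) (i : Fin N) {σ ε : ℝ} (hσ : |σ| = 1) (hε : 0 < ε) :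
    Summable fun t => P.real {ω | ε ≤ σ * (empMean (history X Y arm t ω) i - α i)} := by
  have hmeas : ∀ t, Measurable fun ω => bit (X t ω i) := fun t =>
    (Measurable.of_discrete (f := fun x : Fin N → Bool => bit (x i))).comp (henv.measurable_X t)
  have hind : iIndepFun (fun t ω => σ * (bit (X t ω i) - α i)) P :=
    henv.indep_time.comp (fun _ p => σ * (bit (p.1 i) - α i)) fun _ => Measurable.of_discrete
  have hsub : ∀ t, HasSubgaussianMGF (fun ω => σ * (bit (X t ω i) - α i)) 1 P := by
    intro t
    -- The centred outcome lies in `[-1, 1]`, which gives variance proxy `1` and the geometric ratio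
    -- `exp (-ε ^ 2 / 2)`.
    have h := hasSubgaussianMGF_of_mem_Icc_of_integral_eq_zero (μ := P) (a := -1) (b := 1)
      (X := fun ω => σ * (bit (X t ω i) - α i)) (((hmeas t).sub_const _).const_mul _).aemeasurable
      (ae_of_all _ fun ω => ?_) ?_
    · convert! h using 1
      ext
      norm_num
    · have h0 : 0 ≤ α i := by
        rw [← henv.mean_X 0 i]
        exact integral_nonneg fun ω => bit_nonneg _
      have h1 : α i ≤ 1 := by
        rw [← henv.mean_X 0 i]
        calc ∫ ω, bit (X 0 ω i) ∂P ≤ ∫ _, (1 : ℝ) ∂P :=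
              integral_mono (integrable_comp_of_finite (henv.measurable_X 0) fun y => bit (y i))
                (integrable_const _) fun ω => bit_le_one _
          _ = 1 := by simp
      rw [Set.mem_Icc, ← abs_le, abs_mul, hσ, one_mul, abs_le]
      constructor <;> linarith [bit_nonneg (X t ω i), bit_le_one (X t ω i)]
    · rw [integral_const_mul, integral_sub
        (integrable_comp_of_finite (henv.measurable_X t) fun y => bit (y i))
        (integrable_const _), henv.mean_X]
      simp
  refine Summable.of_norm_bounded_eventually_nat
    (summable_geometric_of_lt_one (Real.exp_pos (-ε ^ 2 / 2)).le
      (Real.exp_lt_one_iff.2 (by nlinarith))) ?_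
  filter_upwards [eventually_gt_atTop 0] with t ht
  have ht' : (0 : ℝ) < t := by exact_mod_cast ht
  have h := HasSubgaussianMGF.measure_sum_range_ge_le_of_iIndepFun hind (n := t)
    (fun j _ => hsub j) (mul_nonneg ht'.le hε.le)
  rw [Real.norm_of_nonneg measureReal_nonneg]
  convert! h using 1
  · congr 1
    ext ω
    have e : ∑ j ∈ Finset.range t, σ * (bit (X j ω i) - α i) =
        t * (σ * (empMean (history X Y arm t ω) i - α i)) := by
      rw [← Finset.mul_sum, Finset.sum_sub_distrib, empMean, Finset.sum_range]
      simp only [history, Finset.sum_const, Finset.card_range, nsmul_eq_mul]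
      field_simp
    simp only [Set.mem_ofPred_eq, e]
    exact (mul_le_mul_iff_right₀ ht').symm
  · rw [← Real.exp_nat_mul]
    congr 1
    simp
    field_simp

/-! ### Thompson samples given the history -/

/-- The law of the Thompson samples, jointly with the history. -/
theorem measureReal_history_inter_sample [IsProbabilityMeasure P]
    (henv : IsEnvironment P α β X Y) (halg : IsAdaPort P X Y θ arm) (t : ℕ) (h : History N t)
    {B : Set (Fin N → ℝ)} (hB : MeasurableSet B) :
    P.real (history X Y arm t ⁻¹' {h} ∩ θ t ⁻¹' B) =
      P.real (history X Y arm t ⁻¹' {h}) * (betaPosterior h).real B := by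
  have hm : MeasurableSet (history X Y arm t ⁻¹' {h}) :=
    measurable_history henv halg t (measurableSet_singleton h)
  by_cases h0 : P (history X Y arm t ⁻¹' {h}) = 0
  · rw [measureReal_def, measureReal_def, h0, measure_mono_null Set.inter_subset_left h0]
    simp
  · rw [← halg.sample t h h0, measureReal_def, measureReal_def, measureReal_def,
      Measure.map_apply (halg.measurable_θ t) hB, cond_apply hm, ENNReal.toReal_mul,
      ENNReal.toReal_inv, mul_inv_cancel_left₀]
    exact (ENNReal.toReal_pos h0 (measure_ne_top _ _)).ne'

theorem betaPosterior_real_pi {t : ℕ} (h : History N t) (J : Fin N → Set ℝ) :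
    (betaPosterior h).real (Set.univ.pi J) =
      ∏ j, (betaMeasure (succCount h j + 1) (failCount h j + 1)).real (J j) := by
  rw [betaPosterior, measureReal_def, Measure.pi_pi, ENNReal.toReal_prod]
  rfl

/-- There are finitely many histories, so conditioning on the history is a finite sum. -/
theorem sum_measureReal_history [IsProbabilityMeasure P] (henv : IsEnvironment P α β X Y)
    (halg : IsAdaPort P X Y θ arm) (t : ℕ) (E : Set Ω) :
    ∑ h, P.real (history X Y arm t ⁻¹' {h} ∩ E) = P.real E := by
  have hm := fun h => measurable_history henv halg t (measurableSet_singleton h)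
  have e := sum_measureReal_preimage_singleton (μ := P.restrict E) (f := history X Y arm t)
    Finset.univ (fun h _ => hm h)
  simpa [measureReal_restrict_apply (hm _)] using e

theorem integral_arm_eq_sum_history [IsProbabilityMeasure P] (henv : IsEnvironment P α β X Y)
    (halg : IsAdaPort P X Y θ arm) (t : ℕ) (i : Fin N) (w : History N t → ℝ) :
    ∫ ω, (if arm t ω = i then w (history X Y arm t ω) else 0) ∂P =
      ∑ h, P.real (history X Y arm t ⁻¹' {h} ∩ arm t ⁻¹' {i}) * w h := by
  have hm := fun h => (measurable_history henv halg t (measurableSet_singleton h)).inter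
    (halg.measurable_arm t (measurableSet_singleton i))
  have e : ∀ ω, (if arm t ω = i then w (history X Y arm t ω) else 0) =
      ∑ h, (history X Y arm t ⁻¹' {h} ∩ arm t ⁻¹' {i}).indicator (fun _ => w h) ω := by
    intro ω
    rw [Finset.sum_eq_single (history X Y arm t ω)]
    · simp [Set.indicator]
    · intro h _ hne
      exact Set.indicator_of_notMem (fun hω => hne hω.1.symm) _
    · simp
  simp_rw [e]
  rw [integral_finsetSum _ fun h _ => (integrable_const _).indicator (hm h)]
  refine Finset.sum_congr rfl fun h _ => ?_
  rw [integral_indicator_const _ (hm h), smul_eq_mul]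

theorem measureReal_arm_counts (henv : IsEnvironment P α β X Y) (halg : IsAdaPort P X Y θ arm)
    (t : ℕ) (i : Fin N) (Q : ℕ → ℕ → Prop) [DecidableRel Q] :
    P.real {ω | arm t ω = i ∧ Q (succCount (history X Y arm t ω) i)
        (failCount (history X Y arm t ω) i)} =
      ∫ ω, (if arm t ω = i then (fun s f => if Q s f then (1 : ℝ) else 0)
        (succCount (history X Y arm t ω) i) (failCount (history X Y arm t ω) i) else 0) ∂P := by
  have hm : MeasurableSet {ω | arm t ω = i ∧ Q (succCount (history X Y arm t ω) i)
      (failCount (history X Y arm t ω) i)} :=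
    measurable_history_arm henv halg t (MeasurableSet.of_discrete
      (s := {p : History N t × Fin N | p.2 = i ∧ Q (succCount p.1 i) (failCount p.1 i)}))
  rw [← integral_indicator_one hm]
  congr 1
  ext ω
  by_cases h1 : arm t ω = i <;>
    by_cases h2 : Q (succCount (history X Y arm t ω) i) (failCount (history X Y arm t ω) i) <;>
      simp [h1, h2]

variable [IsProbabilityMeasure P]

theorem measureReal_mono_of_ae {E F : Set Ω} (h : ∀ᵐ ω ∂P, ω ∈ E → ω ∈ F) :
    P.real E ≤ P.real F :=
  ENNReal.toReal_mono (measure_ne_top _ _) (measure_mono_ae h)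

theorem betaPosterior_real_update {t : ℕ} (h : History N t) (J : Fin N → Set ℝ) (i : Fin N)
    (I : Set ℝ) : (betaPosterior h).real (Set.univ.pi (Function.update J i I)) =
      (betaMeasure (succCount h i + 1) (failCount h i + 1)).real I *
        ∏ j ∈ Finset.univ.erase i,
          (betaMeasure (succCount h j + 1) (failCount h j + 1)).real (J j) := by
  rw [betaPosterior_real_pi, ← Finset.mul_prod_erase _ _ (Finset.mem_univ i),
    Function.update_self]
  congr 1
  refine Finset.prod_congr rfl fun j hj => ?_
  rw [Function.update_of_ne (Finset.ne_of_mem_erase hj)]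

theorem measurableSet_pi_update {J : Fin N → Set ℝ} (hJ : ∀ j, MeasurableSet (J j)) (i : Fin N)
    {I : Set ℝ} (hI : MeasurableSet I) :
    MeasurableSet (Set.univ.pi (Function.update J i I)) := by
  refine MeasurableSet.univ_pi fun j => ?_
  by_cases h : j = i
  · subst h
    simpa using hI
  · simpa [h] using hJ j

/-- The probability that the sample of arm `i` exceeds `y`, jointly with the history. -/
theorem measureReal_history_inter_sample_gt (henv : IsEnvironment P α β X Y)
    (halg : IsAdaPort P X Y θ arm) (t : ℕ) (h : History N t) (i : Fin N) (y : ℝ) :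
    P.real (history X Y arm t ⁻¹' {h} ∩ {ω | y < θ t ω i}) =
      P.real (history X Y arm t ⁻¹' {h}) * betaTail (succCount h i) (failCount h i) y := by
  have e : {ω | y < θ t ω i} =
      θ t ⁻¹' Set.univ.pi (Function.update (fun _ => Set.univ) i (Set.Ioi y)) := by
    ext ω
    simp only [Set.mem_preimage, Set.mem_univ_pi, Set.mem_ofPred_eq]
    constructor
    · intro hω j
      by_cases hj : j = i
      · subst hj
        simpa using hω
      · simp [hj]
    · intro hω
      simpa using hω i
  rw [e, measureReal_history_inter_sample henv halg t h
    (measurableSet_pi_update (fun _ => MeasurableSet.univ) i measurableSet_Ioi),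
    betaPosterior_real_update]
  simp [betaTail]

/-- Playing arm `i` on a sample that is at most `y`, while a sample above `z` of arm `o` would beat
it, is at most as likely as playing arm `o`, up to the posterior odds against such a sample. -/
theorem measureReal_arm_sample_le_le (henv : IsEnvironment P α β X Y)
    (halg : IsAdaPort P X Y θ arm) (t : ℕ) {i o : Fin N} {y z : ℝ} (hz0 : 0 < z) (hz1 : z < 1) :
    P.real {ω | arm t ω = i ∧ θ t ω i ≤ y ∧
        empMean (history X Y arm t ω) i * y < empMean (history X Y arm t ω) o * z} ≤
      ∫ ω, (if arm t ω = o then (betaTail (succCount (history X Y arm t ω) o)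
        (failCount (history X Y arm t ω) o) z)⁻¹ - 1 else 0) ∂P := by
  rw [integral_arm_eq_sum_history henv halg t o fun h =>
    (betaTail (succCount h o) (failCount h o) z)⁻¹ - 1, ← sum_measureReal_history henv halg t]
  refine Finset.sum_le_sum fun h _ => ?_
  have hp := betaTail_pos (succCount h o) (failCount h o) hz0 hz1
  have hnn : 0 ≤ (betaTail (succCount h o) (failCount h o) z)⁻¹ - 1 := by
    linarith [(one_le_inv₀ hp).2 (betaTail_le_one _ _ _)]
  by_cases hgood : empMean h i * y < empMean h o * z
  swap
  · refine le_trans (le_of_eq ?_) (mul_nonneg measureReal_nonneg hnn)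
    convert! measureReal_empty (μ := P) using 2
    ext ω
    simp only [Set.mem_inter_iff, Set.mem_preimage, Set.mem_singleton_iff, Set.mem_ofPred_eq,
      Set.mem_empty_iff_false, iff_false]
    rintro ⟨rfl, -, -, hω⟩
    exact hgood hω
  -- The box of samples for which every arm other than `o` scores below `empMean h o * z`. Only the
  -- side of coordinate `o` is changed below, from at most `z` to above `z`; by independence the two
  -- probabilities are in the ratio `(1 - p) / p`, with `p` the tail of arm `o`.
  let J : Fin N → Set ℝ := fun j => {x | empMean h j * x < empMean h o * z}
  have hJ : ∀ j, MeasurableSet (J j) := fun j =>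
    measurableSet_lt (measurable_id.const_mul _) measurable_const
  have hlow : P.real (history X Y arm t ⁻¹' {h} ∩ {ω | arm t ω = i ∧ θ t ω i ≤ y ∧
        empMean (history X Y arm t ω) i * y < empMean (history X Y arm t ω) o * z}) ≤
      P.real (history X Y arm t ⁻¹' {h} ∩
        θ t ⁻¹' Set.univ.pi (Function.update J o (Set.Iic z))) := by
    refine measureReal_mono_of_ae ?_
    filter_upwards [halg.argmax t] with ω hω
    rintro ⟨rfl, rfl, hy, -⟩
    have hlt : ∀ j, empMean (history X Y arm t ω) j * θ t ω j <
        empMean (history X Y arm t ω) o * z := fun j =>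
      (hω j).trans_lt ((mul_le_mul_of_nonneg_left hy (empMean_nonneg _ _)).trans_lt hgood)
    refine ⟨rfl, fun j _ => ?_⟩
    by_cases hj : j = o
    · subst hj
      rw [Function.update_self]
      exact (lt_of_mul_lt_mul_left (hlt j) (empMean_nonneg _ _)).le
    · rw [Function.update_of_ne hj]
      exact hlt j
  -- The strict inequality in `J` makes `o` the unique maximizer here, so the tie-breaking rule is
  -- irrelevant.
  have hhigh : P.real (history X Y arm t ⁻¹' {h} ∩
        θ t ⁻¹' Set.univ.pi (Function.update J o (Set.Ioi z))) ≤
      P.real (history X Y arm t ⁻¹' {h} ∩ arm t ⁻¹' {o}) := by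
    refine measureReal_mono_of_ae ?_
    filter_upwards [halg.argmax t] with ω hω
    rintro ⟨rfl, hmem⟩
    refine ⟨rfl, ?_⟩
    by_contra hne
    have h1 : θ t ω (arm t ω) ∈ J (arm t ω) := by
      have := hmem (arm t ω) (Set.mem_univ _)
      rwa [Function.update_of_ne hne] at this
    have h2 : z < θ t ω o := by
      have := hmem o (Set.mem_univ _)
      rwa [Function.update_self] at this
    have h3 := mul_le_mul_of_nonneg_left h2.le (empMean_nonneg (history X Y arm t ω) o)
    exact absurd ((hω o).trans_lt h1) (not_lt.2 h3)
  refine hlow.trans (le_trans (le_of_eq ?_) (mul_le_mul_of_nonneg_right hhigh hnn))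
  have hIic : (betaMeasure (succCount h o + 1) (failCount h o + 1)).real (Set.Iic z) =
      1 - betaTail (succCount h o) (failCount h o) z := by
    rw [betaTail, ← Set.compl_Ioi, probReal_compl_eq_one_sub measurableSet_Ioi]
  rw [measureReal_history_inter_sample henv halg t h (measurableSet_pi_update hJ o
      measurableSet_Iic), measureReal_history_inter_sample henv halg t h
      (measurableSet_pi_update hJ o measurableSet_Ioi), betaPosterior_real_update,
    betaPosterior_real_update, hIic]
  change _ = P.real (history X Y arm t ⁻¹' {h}) *
    (betaTail (succCount h o) (failCount h o) z * _) * _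
  field_simp

/-! ### Expected number of plays of an arm -/

theorem step_iterate_indicator_add (b : ℝ) (L : ℝ) (k : ℕ) :
    (step b)^[k] (fun s f => if (s + f : ℝ) < L then 1 else 0) 0 0 =
      if (k : ℝ) < L then 1 else 0 := by
  rw [step_iterate_zero_zero]
  calc _ = ∑ p ∈ Finset.HasAntidiagonal.antidiagonal k, (k.choose p.1 : ℝ) *
        (b ^ p.1 * (1 - b) ^ p.2) * (if (k : ℝ) < L then 1 else 0) := by
        refine Finset.sum_congr rfl fun p hp => ?_
        have hk : (p.1 : ℝ) + p.2 = k := by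
          exact_mod_cast Finset.HasAntidiagonal.mem_antidiagonal.1 hp
        rw [hk]
        ring
    _ = _ := by rw [← Finset.sum_mul, sum_binomial_antidiagonal, one_mul]

/-- After `k` observations the count is exactly `k`, so at most `⌈L⌉₊` terms of the dominating sum
survive. -/
theorem sum_measureReal_arm_count_lt_le (henv : IsEnvironment P α β X Y)
    (halg : IsAdaPort P X Y θ arm) (i : Fin N) {L : ℝ} (hL : 0 ≤ L) (T : ℕ) :
    ∑ t ∈ Finset.range T, P.real {ω | arm t ω = i ∧ (succCount (history X Y arm t ω) i +
      failCount (history X Y arm t ω) i : ℝ) < L} ≤ L + 1 := by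
  classical
  have h := sum_integral_arm_le henv halg i (g := fun s f => if (s + f : ℝ) < L then 1 else 0)
    (fun s f => by split_ifs <;> norm_num) T
  simp_rw [step_iterate_indicator_add] at h
  simp_rw [measureReal_arm_counts henv halg _ i fun s f => (s + f : ℝ) < L]
  refine h.trans ?_
  rw [Finset.sum_ite, Finset.sum_const_zero, add_zero, Finset.sum_const, nsmul_eq_mul, mul_one]
  have hc : (Finset.filter (fun k : ℕ => (k : ℝ) < L) (Finset.range T)).card ≤ ⌈L⌉₊ := by
    rw [← Finset.card_range ⌈L⌉₊]
    refine Finset.card_le_card fun k hk => ?_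
    exact Finset.mem_range.2 (Nat.lt_ceil.2 (Finset.mem_filter.1 hk).2)
  have := Nat.ceil_lt_add_one hL
  have hc' : ((Finset.filter (fun k : ℕ => (k : ℝ) < L) (Finset.range T)).card : ℝ) ≤ ⌈L⌉₊ := by
    exact_mod_cast hc
  linarith

/-- From `log u ≤ u - 1` in the first term only. Keeping the second term gives both positivity and
the blow-up as `y → 1`, and `x = 0` is covered. -/
theorem bernoulliKL_ge_add {x y : ℝ} (hx0 : 0 ≤ x) (hy0 : 0 < y) :
    x - y + (1 - x) * Real.log ((1 - x) / (1 - y)) ≤ bernoulliKL x y := by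
  rw [bernoulliKL]
  refine add_le_add ?_ le_rfl
  rcases hx0.eq_or_lt with rfl | hx0
  · simp [hy0.le]
  · have h := Real.log_le_sub_one_of_pos (div_pos hy0 hx0)
    rw [← inv_div, Real.log_inv]
    have e : x * (y / x - 1) = y - x := by field_simp
    nlinarith

theorem bernoulliKL_pos {x y : ℝ} (hx0 : 0 ≤ x) (hxy : x < y) (hy1 : y < 1) :
    0 < bernoulliKL x y := by
  have h1 : 0 < 1 - x := by linarith
  have h2 : 0 < 1 - y := by linarith
  refine lt_of_lt_of_le ?_ (bernoulliKL_ge_add hx0 (hx0.trans_lt hxy))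
  have h := Real.log_lt_sub_one_of_pos (div_pos h2 h1) ((div_lt_one h1).2 (by linarith)).ne
  rw [← inv_div, Real.log_inv]
  have e : (1 - x) * ((1 - y) / (1 - x) - 1) = x - y := by
    field_simp
    ring
  nlinarith

/-- A sample above `y` is unlikely once an arm with success rate at most `x < y` has been played
often. -/
theorem measureReal_sample_gt_le_exp (henv : IsEnvironment P α β X Y)
    (halg : IsAdaPort P X Y θ arm) (t : ℕ) (i : Fin N) {x y L : ℝ} (hx0 : 0 < x) (hxy : x < y)
    (hy1 : y < 1) :
    P.real {ω | L ≤ (succCount (history X Y arm t ω) i + failCount (history X Y arm t ω) i : ℝ) ∧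
        (succCount (history X Y arm t ω) i : ℝ) ≤
          x * (succCount (history X Y arm t ω) i + failCount (history X Y arm t ω) i) ∧
        y < θ t ω i} ≤ Real.exp (-(L * bernoulliKL x y)) := by
  have hd := bernoulliKL_pos hx0.le hxy hy1
  rw [← sum_measureReal_history henv halg t, ← one_mul (Real.exp _)]
  have h1 := sum_measureReal_history henv halg t Set.univ
  simp only [Set.inter_univ, probReal_univ] at h1
  rw [← h1, Finset.sum_mul]
  refine Finset.sum_le_sum fun h _ => ?_
  by_cases hh : L ≤ (succCount h i + failCount h i : ℝ) ∧
      (succCount h i : ℝ) ≤ x * (succCount h i + failCount h i)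
  · refine (measureReal_mono (Set.inter_subset_inter_right _
      (show _ ⊆ {ω | y < θ t ω i} from fun ω hω => hω.2.2))).trans ?_
    rw [measureReal_history_inter_sample_gt henv halg]
    refine mul_le_mul_of_nonneg_left ?_ measureReal_nonneg
    refine (betaTail_le_exp_neg_bernoulliKL hx0 hxy hy1 hh.2).trans ?_
    exact Real.exp_le_exp.2 (neg_le_neg (mul_le_mul_of_nonneg_right hh.1 hd.le))
  · refine le_trans (le_of_eq ?_) (mul_nonneg measureReal_nonneg (Real.exp_pos _).le)
    convert! measureReal_empty (μ := P) using 2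
    ext ω
    simp only [Set.mem_inter_iff, Set.mem_preimage, Set.mem_singleton_iff, Set.mem_ofPred_eq,
      Set.mem_empty_iff_false, iff_false]
    rintro ⟨rfl, h2, h3, -⟩
    exact hh ⟨h2, h3⟩

theorem measureReal_one_lt_sample (henv : IsEnvironment P α β X Y)
    (halg : IsAdaPort P X Y θ arm) (t : ℕ) (i : Fin N) : P.real {ω | 1 < θ t ω i} = 0 := by
  rw [← sum_measureReal_history henv halg t]
  refine Finset.sum_eq_zero fun h _ => ?_
  rw [measureReal_history_inter_sample_gt henv halg, betaTail_eq_binomCDF _ _ zero_le_one le_rfl,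
    binomCDF_one (by omega), mul_zero]

/-- Up to a constant, all the plays of arm `i` are made on samples above `y`. -/
theorem exists_sum_measureReal_arm_le_add_sample_gt (henv : IsEnvironment P α β X Y)
    (halg : IsAdaPort P X Y θ arm) {i o : Fin N} {y z : ℝ} (hy : 0 ≤ y) (hz0 : 0 < z)
    (hzo : z < β o) (hyz : α i * y < α o * z) :
    ∃ C : ℝ, ∀ T : ℕ, ∑ t ∈ Finset.range T, P.real {ω | arm t ω = i} ≤
      ∑ t ∈ Finset.range T, P.real {ω | arm t ω = i ∧ y < θ t ω i} + C := by
  have hb := (success_rate_mem_Icc henv o).2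
  -- The error in the two empirical means at which the scores `α i * y` and `α o * z` meet.
  obtain ⟨ε, hε, hεyz⟩ : ∃ ε > 0, (α i + ε) * y ≤ (α o - ε) * z := by
    refine ⟨(α o * z - α i * y) / (y + z), div_pos (by linarith) (by linarith), le_of_eq ?_⟩
    have : y + z ≠ 0 := by linarith
    field_simp
    ring
  have s1 := summable_empMean_deviation henv arm i (σ := 1) (by simp) hε
  have s2 := summable_empMean_deviation henv arm o (σ := -1) (by simp) hε
  have s3 := summable_step_iterate_inv_betaTail hz0 hzo hb
  have hnn : ∀ s f, 0 ≤ (betaTail s f z)⁻¹ - 1 := fun s f => by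
    linarith [(one_le_inv₀ (betaTail_pos s f hz0 (hzo.trans_le hb))).2 (betaTail_le_one s f z)]
  refine ⟨(∑' k, (step (β o))^[k] (fun s f => (betaTail s f z)⁻¹ - 1) 0 0) +
    (∑' t, P.real {ω | ε ≤ 1 * (empMean (history X Y arm t ω) i - α i)}) +
    ∑' t, P.real {ω | ε ≤ -1 * (empMean (history X Y arm t ω) o - α o)}, fun T => ?_⟩
  have hstep : ∀ t, P.real {ω | arm t ω = i} ≤ P.real {ω | arm t ω = i ∧ y < θ t ω i} +
      (P.real {ω | arm t ω = i ∧ θ t ω i ≤ y ∧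
        empMean (history X Y arm t ω) i * y < empMean (history X Y arm t ω) o * z} +
      (P.real {ω | ε ≤ 1 * (empMean (history X Y arm t ω) i - α i)} +
        P.real {ω | ε ≤ -1 * (empMean (history X Y arm t ω) o - α o)})) := by
    intro t
    refine le_trans (measureReal_mono fun ω hω => ?_) ((measureReal_union_le _ _).trans
      (add_le_add le_rfl ((measureReal_union_le _ _).trans
        (add_le_add le_rfl (measureReal_union_le _ _)))))
    by_cases h1 : y < θ t ω i
    · exact Or.inl ⟨hω, h1⟩
    by_cases h2 : ε ≤ 1 * (empMean (history X Y arm t ω) i - α i)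
    · exact Or.inr (Or.inr (Or.inl h2))
    by_cases h3 : ε ≤ -1 * (empMean (history X Y arm t ω) o - α o)
    · exact Or.inr (Or.inr (Or.inr h3))
    refine Or.inr (Or.inl ⟨hω, not_lt.1 h1, ?_⟩)
    rw [not_le] at h2 h3
    calc empMean (history X Y arm t ω) i * y ≤ (α i + ε) * y :=
          mul_le_mul_of_nonneg_right (by linarith) hy
      _ ≤ (α o - ε) * z := hεyz
      _ < empMean (history X Y arm t ω) o * z := mul_lt_mul_of_pos_right (by linarith) hz0
  refine (Finset.sum_le_sum fun t _ => hstep t).trans ?_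
  rw [Finset.sum_add_distrib, Finset.sum_add_distrib, Finset.sum_add_distrib]
  have b3 := (Finset.sum_le_sum fun t (_ : t ∈ Finset.range T) => measureReal_arm_sample_le_le
    henv halg t (i := i) (o := o) (y := y) hz0 (hzo.trans_le hb)).trans
    ((sum_integral_arm_le henv halg o hnn T).trans (s3.sum_le_tsum _ fun k _ =>
      step_iterate_nonneg (hz0.trans hzo).le hb hnn k 0 0))
  have b1 := s1.sum_le_tsum (Finset.range T) fun t _ => measureReal_nonneg
  have b2 := s2.sum_le_tsum (Finset.range T) fun t _ => measureReal_nonneg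
  linarith

/-- The number of plays of an arm whose score is below that of arm `o` unless the sample exceeds
`y > x > β i`. -/
theorem exists_sum_measureReal_arm_le_log (henv : IsEnvironment P α β X Y)
    (halg : IsAdaPort P X Y θ arm) {i o : Fin N} {x y z : ℝ} (hx : β i < x) (hxy : x < y)
    (hy1 : y < 1) (hz0 : 0 < z) (hzo : z < β o) (hyz : α i * y < α o * z) :
    ∃ C : ℝ, ∀ T : ℕ, 0 < T → ∑ t ∈ Finset.range T, P.real {ω | arm t ω = i} ≤
      Real.log T / bernoulliKL x y + C := by
  classical
  have hbi := (success_rate_mem_Icc henv i).1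
  have hx0 : 0 < x := hbi.trans_lt hx
  have hd := bernoulliKL_pos hx0.le hxy hy1
  obtain ⟨C, hC⟩ := exists_sum_measureReal_arm_le_add_sample_gt henv halg (hx0.trans hxy).le hz0
    hzo hyz
  have s1 := summable_step_iterate_indicator hbi hx (hxy.trans hy1).le
  -- One `1` comes from rounding `L` up, the other is `T * exp (-(L * d)) = T * (1 / T)`; the series
  -- counts the slots with success rate above `x`, and `C` those with sample at most `y`.
  refine ⟨1 + 1 + (∑' k, (step (β i))^[k] (fun s f => if x * (s + f) < s then 1 else 0) 0 0) + C,
    fun T hT => (hC T).trans ?_⟩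
  set L := Real.log T / bernoulliKL x y with hLdef
  have hT' : (1 : ℝ) ≤ T := by exact_mod_cast hT
  have hL : 0 ≤ L := div_nonneg (Real.log_nonneg hT') hd.le
  have hstep : ∀ t, P.real {ω | arm t ω = i ∧ y < θ t ω i} ≤
      P.real {ω | arm t ω = i ∧ (succCount (history X Y arm t ω) i +
        failCount (history X Y arm t ω) i : ℝ) < L} +
      (P.real {ω | arm t ω = i ∧ x * (succCount (history X Y arm t ω) i +
        failCount (history X Y arm t ω) i) < (succCount (history X Y arm t ω) i : ℝ)} +
      Real.exp (-(L * bernoulliKL x y))) := by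
    intro t
    refine le_trans (measureReal_mono fun ω hω => ?_) ((measureReal_union_le _ _).trans
      (add_le_add le_rfl ((measureReal_union_le _ _).trans
        (add_le_add le_rfl (measureReal_sample_gt_le_exp henv halg t i hx0 hxy hy1)))))
    by_cases h1 : (succCount (history X Y arm t ω) i +
        failCount (history X Y arm t ω) i : ℝ) < L
    · exact Or.inl ⟨hω.1, h1⟩
    by_cases h2 : x * (succCount (history X Y arm t ω) i +
        failCount (history X Y arm t ω) i) < (succCount (history X Y arm t ω) i : ℝ)
    · exact Or.inr (Or.inl ⟨hω.1, h2⟩)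
    exact Or.inr (Or.inr ⟨not_lt.1 h1, not_lt.1 h2, hω.2⟩)
  have hsum := Finset.sum_le_sum fun t (_ : t ∈ Finset.range T) => hstep t
  rw [Finset.sum_add_distrib, Finset.sum_add_distrib, Finset.sum_const, Finset.card_range,
    nsmul_eq_mul, hLdef, div_mul_cancel₀ _ hd.ne', Real.exp_neg, Real.exp_log (by linarith),
    mul_inv_cancel₀ (by linarith), ← hLdef] at hsum
  have b1 := sum_measureReal_arm_count_lt_le henv halg i hL T
  have hg : ∀ s f : ℕ, (0 : ℝ) ≤ if x * (s + f) < (s : ℝ) then 1 else 0 := fun s f => by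
    split_ifs <;> norm_num
  have b2 := (sum_integral_arm_le henv halg i hg T).trans (s1.sum_le_tsum _ fun k _ =>
    step_iterate_nonneg hbi (hx.le.trans (hxy.trans hy1).le) hg k 0 0)
  simp_rw [measureReal_arm_counts henv halg _ i fun s f => x * (s + f : ℝ) < (s : ℝ)] at hsum
  linarith

/-! ### Continuity and blow-up of the divergence -/

/-- In this form continuity in `x` reaches `x = 0`, since `x * log x` is continuous there. -/
theorem bernoulliKL_eq_add_mul_log {x y : ℝ} (hx0 : 0 ≤ x) (hx1 : x < 1) (hy0 : 0 < y)
    (hy1 : y < 1) : bernoulliKL x y =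
      x * Real.log x + (1 - x) * Real.log (1 - x) - x * Real.log y -
        (1 - x) * Real.log (1 - y) := by
  have h1 : 0 < 1 - x := by linarith
  have h2 : 0 < 1 - y := by linarith
  rw [bernoulliKL, Real.log_div h1.ne' h2.ne']
  rcases hx0.eq_or_lt with rfl | hx0
  · simp
  · rw [Real.log_div hx0.ne' hy0.ne']
    ring

theorem exists_inv_bernoulliKL_lt_left {b y c : ℝ} (hb : 0 ≤ b) (hby : b < y) (hy1 : y < 1)
    (h : 1 / bernoulliKL b y < c) : ∃ x, b < x ∧ x < y ∧ 1 / bernoulliKL x y < c := by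
  have hd := bernoulliKL_pos hb hby hy1
  have hy0 : 0 < y := hb.trans_lt hby
  have hcont : ContinuousAt (fun x => 1 / (x * Real.log x + (1 - x) * Real.log (1 - x) -
      x * Real.log y - (1 - x) * Real.log (1 - y))) b := by
    refine ContinuousAt.div continuousAt_const (Continuous.continuousAt ?_) ?_
    · have h1 := Real.continuous_mul_log
      have h2 : Continuous fun x : ℝ => (1 - x) * Real.log (1 - x) :=
        h1.comp (continuous_const.sub continuous_id)
      fun_prop
    · rw [← bernoulliKL_eq_add_mul_log hb (hby.trans hy1) hy0 hy1]
      exact hd.ne'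
  rw [bernoulliKL_eq_add_mul_log hb (hby.trans hy1) hy0 hy1] at h
  obtain ⟨x, ⟨hxc, hxy⟩, hbx⟩ := ((((hcont.eventually_lt_const h).and
    (eventually_lt_nhds hby)).filter_mono
    (nhdsWithin_le_nhds (s := Set.Ioi b))).and self_mem_nhdsWithin).exists
  refine ⟨x, hbx, hxy, ?_⟩
  rwa [bernoulliKL_eq_add_mul_log (hb.trans hbx.le) (hxy.trans hy1) hy0 hy1]

theorem exists_inv_bernoulliKL_lt_right {b q c : ℝ} (hb : 0 ≤ b) (hbq : b < q) (hq1 : q < 1)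
    (h : 1 / bernoulliKL b q < c) : ∃ y, b < y ∧ y < q ∧ 1 / bernoulliKL b y < c := by
  have hd := bernoulliKL_pos hb hbq hq1
  have hq0 : 0 < q := hb.trans_lt hbq
  have hcont : ContinuousAt (fun y => 1 / bernoulliKL b y) q := by
    refine ContinuousAt.div continuousAt_const ?_ hd.ne'
    have he : (fun y => b * Real.log b + (1 - b) * Real.log (1 - b) -
        b * Real.log y - (1 - b) * Real.log (1 - y)) =ᶠ[nhds q] fun y => bernoulliKL b y := by
      filter_upwards [Ioo_mem_nhds hq0 hq1] with y hy
      exact (bernoulliKL_eq_add_mul_log hb (hbq.trans hq1) hy.1 hy.2).symm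
    refine ContinuousAt.congr ?_ he
    have h1 : ContinuousAt Real.log q := Real.continuousAt_log hq0.ne'
    have h2 : ContinuousAt (fun y => Real.log (1 - y)) q :=
      (continuousAt_const.sub continuousAt_id).log (sub_pos.2 hq1).ne'
    fun_prop
  obtain ⟨y, ⟨hyc, hby⟩, hyq⟩ := ((((hcont.eventually_lt_const h).and
    (eventually_gt_nhds hbq)).filter_mono
    (nhdsWithin_le_nhds (s := Set.Iio q))).and self_mem_nhdsWithin).exists
  exact ⟨y, hby, hyq, hyc⟩

theorem exists_inv_bernoulliKL_lt_of_pos {b c : ℝ} (hb : 0 ≤ b) (hb1 : b < 1) (hc : 0 < c) :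
    ∃ y, b < y ∧ y < 1 ∧ 1 / bernoulliKL b y < c := by
  have h1 : 0 < 1 - b := by linarith
  -- With `1 - y = (1 - b) * exp (-K)` the logarithmic term of the lower bound is exactly `1 / c +
  -- 2`, and `b - y > -1` cannot spoil it.
  set K := (1 / c + 2) / (1 - b) with hK
  have hK0 : 0 < K := by positivity
  have he := Real.exp_pos (-K)
  have he1 : Real.exp (-K) < 1 := Real.exp_lt_one_iff.2 (by linarith)
  have hy : b < 1 - (1 - b) * Real.exp (-K) := by nlinarith
  refine ⟨1 - (1 - b) * Real.exp (-K), hy, by nlinarith, ?_⟩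
  have h := bernoulliKL_ge_add hb (hb.trans_lt hy)
  have e : (1 - b) * Real.log ((1 - b) / (1 - (1 - (1 - b) * Real.exp (-K)))) = 1 / c + 2 := by
    rw [show (1 - b) / (1 - (1 - (1 - b) * Real.exp (-K))) = Real.exp K by
      rw [sub_sub_cancel, Real.exp_neg]
      field_simp, Real.log_exp, hK, mul_div_cancel₀ _ h1.ne']
  rw [e] at h
  have h2 : 1 / c < bernoulliKL b (1 - (1 - b) * Real.exp (-K)) := by nlinarith
  have hc' : 0 < 1 / c := by positivity
  rw [div_lt_iff₀ (hc'.trans h2)]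
  rw [div_lt_iff₀ hc] at h2
  linarith

/-! ### Asymptotics of the plays and of the regret -/

/-- A suboptimal arm is played at most about `log T / d(β i, α o * β o / α i)` times if
`α o * β o < α i`, and `o(log T)` times otherwise. -/
theorem eventually_sum_measureReal_arm_le (henv : IsEnvironment P α β X Y)
    (halg : IsAdaPort P X Y θ arm) {i o : Fin N} (hio : α i * β i < α o * β o) {c : ℝ}
    (hc0 : 0 < c)
    (hc : α o * β o < α i → 1 / bernoulliKL (β i) (α o * β o / α i) < c) :
    ∀ᶠ T : ℕ in atTop, ∑ t ∈ Finset.range T, P.real {ω | arm t ω = i} ≤ c * Real.log T := by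
  have hα : ∀ j, 0 ≤ α j := fun j => by
    rw [← henv.mean_X 0 j]
    exact integral_nonneg fun ω => bit_nonneg _
  obtain ⟨hbi, hbi1⟩ := success_rate_mem_Icc henv i
  have hμ : 0 < α o * β o := (mul_nonneg (hα i) hbi).trans_lt hio
  have hβo : 0 < β o := pos_of_mul_pos_right hμ (hα o)
  have hαo : 0 < α o := (pos_iff_pos_of_mul_pos hμ).2 hβo
  have hlog : Tendsto (fun T : ℕ => Real.log T) atTop atTop :=
    Real.tendsto_log_atTop.comp tendsto_natCast_atTop_atTop
  have hz : ∀ y, α i * y < α o * β o → ∃ z, 0 < z ∧ z < β o ∧ α i * y < α o * z := by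
    intro y hy
    obtain ⟨z, hz1, hz2⟩ := exists_between (show max 0 (α i * y / α o) < β o from
      max_lt hβo ((div_lt_iff₀' hαo).2 hy))
    exact ⟨z, (le_max_left _ _).trans_lt hz1, hz2,
      (div_lt_iff₀' hαo).1 ((le_max_right _ _).trans_lt hz1)⟩
  have hrate : ∀ x y, β i < x → x < y → y < 1 → α i * y < α o * β o → 1 / bernoulliKL x y < c →
      ∀ᶠ T : ℕ in atTop, ∑ t ∈ Finset.range T, P.real {ω | arm t ω = i} ≤ c * Real.log T := by
    intro x y hx hxy hy1 hαy hlt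
    obtain ⟨z, hz0, hzo, hyz⟩ := hz y hαy
    obtain ⟨C, hC⟩ := exists_sum_measureReal_arm_le_log henv halg hx hxy hy1 hz0 hzo hyz
    -- The slack `c - 1 / bernoulliKL x y`, times `log T`, eventually exceeds the constant `C`.
    filter_upwards [eventually_gt_atTop 0,
      hlog.eventually_ge_atTop (C / (c - 1 / bernoulliKL x y))] with T hT hTC
    rw [div_le_iff₀ (by linarith)] at hTC
    refine (hC T hT).trans ?_
    rw [div_eq_mul_one_div]
    linarith
  -- Below the threshold, `y = 1` is admissible and almost no sample exceeds it, so the expected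
  -- number of plays stays bounded.
  rcases lt_or_ge (α i) (α o * β o) with hlt | hge
  · obtain ⟨z, hz0, hzo, hyz⟩ := hz 1 (by linarith)
    obtain ⟨C, hC⟩ := exists_sum_measureReal_arm_le_add_sample_gt henv halg zero_le_one hz0 hzo hyz
    filter_upwards [hlog.eventually_ge_atTop (C / c)] with T hTC
    rw [div_le_iff₀ hc0] at hTC
    refine (hC T).trans ?_
    rw [Finset.sum_eq_zero fun t _ => measureReal_mono_null (fun ω hω => hω.2)
      (measureReal_one_lt_sample henv halg t i)]
    linarith
  have hαi : 0 < α i := hμ.trans_le hge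
  obtain ⟨y, hby, hy1, hαy, hyc⟩ : ∃ y, β i < y ∧ y < 1 ∧ α i * y < α o * β o ∧
      1 / bernoulliKL (β i) y < c := by
    -- At equality the critical value of `y` is `1`, where the divergence becomes infinite, so any
    -- `c > 0` is attained.
    rcases hge.eq_or_lt with heq | hgt
    · have hb1 : β i < 1 := by nlinarith
      obtain ⟨y, h1, h2, h3⟩ := exists_inv_bernoulliKL_lt_of_pos hbi hb1 hc0
      exact ⟨y, h1, h2, by nlinarith, h3⟩
    · have hq1 : α o * β o / α i < 1 := (div_lt_one hαi).2 hgt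
      obtain ⟨y, h1, h2, h3⟩ := exists_inv_bernoulliKL_lt_right hbi
        ((lt_div_iff₀' hαi).2 hio) hq1 (hc hgt)
      exact ⟨y, h1, h2.trans hq1, (lt_div_iff₀' hαi).1 h2, h3⟩
  obtain ⟨x, hx, hxy, hxc⟩ := exists_inv_bernoulliKL_lt_left hbi hby hy1 hyc
  exact hrate x y hx hxy hy1 hαy hxc

theorem sum_measureReal_arm_eq_one (halg : IsAdaPort P X Y θ arm) (t : ℕ) :
    ∑ i, P.real {ω | arm t ω = i} = 1 := by
  have h := sum_measureReal_preimage_singleton (μ := P) (f := arm t) Finset.univ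
    (fun i _ => halg.measurable_arm t (measurableSet_singleton i))
  rw [Finset.coe_univ, Set.preimage_univ, probReal_univ] at h
  exact h

/-- The regret is the sum of the gaps of the arms, weighted by their expected numbers of plays. -/
theorem regret_eq_sum (henv : IsEnvironment P α β X Y) (halg : IsAdaPort P X Y θ arm)
    (o : Fin N) (T : ℕ) : regret P X Y arm o T =
      ∑ i, (α o * β o - α i * β i) * ∑ t ∈ Finset.range T, P.real {ω | arm t ω = i} := by
  have hXY : ∀ t, Measurable fun ω => (X t ω, Y t ω) := fun t =>
    (henv.measurable_X t).prodMk (henv.measurable_Y t)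
  have hmean : ∀ t i, ∫ ω, reward X Y t ω i ∂P = α i * β i := by
    intro t i
    rw [← henv.mean_X t i, ← henv.mean_Y t i]
    exact ((henv.indep_XY t i).comp (φ := bit) (ψ := bit) Measurable.of_discrete
      Measurable.of_discrete).integral_fun_mul_eq_mul_integral
      (integrable_comp_of_finite (henv.measurable_X t) fun x => bit (x i)).aestronglyMeasurable
      (integrable_comp_of_finite (henv.measurable_Y t) fun x => bit (x i)).aestronglyMeasurable
  have hint : ∀ t i, Integrable (fun ω => reward X Y t ω i) P := fun t i =>
    integrable_comp_of_finite (hXY t) fun p => bit (p.1 i) * bit (p.2 i)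
  have hone : ∀ t (i : Fin N),
      ∫ ω, (if arm t ω = i then (1 : ℝ) else 0) ∂P = P.real {ω | arm t ω = i} := by
    intro t i
    have hm : MeasurableSet {ω | arm t ω = i} :=
      halg.measurable_arm t (measurableSet_singleton i)
    rw [← integral_indicator_one hm]
    congr 1
    ext ω
    by_cases h : arm t ω = i <;> simp [h]
  have hi : ∀ t i, Integrable (fun ω => reward X Y t ω i * if arm t ω = i then 1 else 0) P :=
    fun t i => integrable_comp_of_finite ((hXY t).prodMk (halg.measurable_arm t))
      fun p => bit (p.1.1 i) * bit (p.1.2 i) * if p.2 = i then 1 else 0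
  have hplay : ∀ t, ∫ ω, reward X Y t ω (arm t ω) ∂P =
      ∑ i, α i * β i * P.real {ω | arm t ω = i} := by
    intro t
    have e : ∀ ω, reward X Y t ω (arm t ω) =
        ∑ i, reward X Y t ω i * if arm t ω = i then 1 else 0 := by
      intro ω
      simp
    simp_rw [e]
    rw [integral_finsetSum _ fun i _ => hi t i]
    refine Finset.sum_congr rfl fun i _ => ?_
    rw [← hmean t i, ← hone t i]
    exact integral_outcome_mul henv halg t (fun p => bit (p.1 i) * bit (p.2 i))
      fun p => if p.2 = i then 1 else 0
  have hintarm : ∀ t, Integrable (fun ω => reward X Y t ω (arm t ω)) P := fun t =>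
    integrable_comp_of_finite ((hXY t).prodMk (halg.measurable_arm t))
      fun p => bit (p.1.1 p.2) * bit (p.1.2 p.2)
  simp_rw [Finset.mul_sum]
  rw [regret, Finset.sum_comm]
  refine Finset.sum_congr rfl fun t _ => ?_
  rw [integral_sub (hint t o) (hintarm t), hmean, hplay]
  simp_rw [sub_mul]
  rw [Finset.sum_sub_distrib, ← Finset.mul_sum, sum_measureReal_arm_eq_one halg, mul_one]

theorem eventually_regret_le (henv : IsEnvironment P α β X Y) (halg : IsAdaPort P X Y θ arm)
    {o : Fin N} (hopt : ∀ i, α i * β i ≤ α o * β o) {b : ℝ}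
    (hb : ∑ i with i ≠ o ∧ α o * β o < α i,
      (α o * β o - α i * β i) / bernoulliKL (β i) (α o * β o / α i) < b) :
    ∀ᶠ T : ℕ in atTop, regret P X Y arm o T ≤ b * Real.log T := by
  set Δ : Fin N → ℝ := fun i => α o * β o - α i * β i with hΔ
  have hΔ0 : ∀ i, 0 ≤ Δ i := fun i => sub_nonneg.2 (hopt i)
  set r : Fin N → ℝ := fun i =>
    if α o * β o < α i then 1 / bernoulliKL (β i) (α o * β o / α i) else 0 with hr
  have hrhs : ∑ i with i ≠ o ∧ α o * β o < α i,
      (α o * β o - α i * β i) / bernoulliKL (β i) (α o * β o / α i) = ∑ i, Δ i * r i := by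
    rw [Finset.sum_filter]
    refine Finset.sum_congr rfl fun i _ => ?_
    by_cases h1 : i = o
    · subst h1
      simp [hΔ]
    · by_cases h2 : α o * β o < α i
      · simp only [h1, h2, ne_eq, not_false_eq_true, and_self, if_true, hΔ, hr]
        rw [div_eq_mul_one_div]
      · simp [h2, hr]
  rw [hrhs] at hb
  have hK : 0 ≤ ∑ i, Δ i := Finset.sum_nonneg fun i _ => hΔ0 i
  -- The slack below `b` is shared among the arms as an excess `δ` in each rate; the `+ 1` guards
  -- against all gaps being zero.
  set δ := (b - ∑ i, Δ i * r i) / (∑ i, Δ i + 1) with hδ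
  have hδ0 : 0 < δ := div_pos (by linarith) (by linarith)
  have hδK : δ * ∑ i, Δ i ≤ b - ∑ i, Δ i * r i := by
    rw [hδ, div_mul_eq_mul_div, div_le_iff₀ (by linarith)]
    nlinarith
  have harm : ∀ i, ∀ᶠ T : ℕ in atTop, Δ i * ∑ t ∈ Finset.range T, P.real {ω | arm t ω = i} ≤
      Δ i * ((r i + δ) * Real.log T) := by
    intro i
    -- Another optimal arm may be played linearly often; its zero gap removes it.
    rcases (hΔ0 i).eq_or_lt with h | h
    · simp [← h]
    · have hi : α i * β i < α o * β o := sub_pos.1 h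
      have hr0 : 0 ≤ r i := by
        simp only [hr]
        split_ifs with h2
        · have hbi := (success_rate_mem_Icc henv i).1
          have hαo : 0 ≤ α o * β o := by
            refine mul_nonneg ?_ (success_rate_mem_Icc henv o).1
            rw [← henv.mean_X 0 o]
            exact integral_nonneg fun ω => bit_nonneg _
          have hαi : 0 < α i := hαo.trans_lt h2
          exact one_div_nonneg.2 (bernoulliKL_pos hbi ((lt_div_iff₀' hαi).2 hi)
            ((div_lt_one hαi).2 h2)).le
        · exact le_rfl
      filter_upwards [eventually_sum_measureReal_arm_le henv halg hi (c := r i + δ) (by linarith)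
        fun h2 => by simp only [hr, h2, if_true]; linarith] with T hT
      exact mul_le_mul_of_nonneg_left hT h.le
  filter_upwards [eventually_all.2 harm, eventually_ge_atTop 1] with T hT hT1
  have hlog : 0 ≤ Real.log T := Real.log_nonneg (by exact_mod_cast hT1)
  rw [regret_eq_sum henv halg]
  calc ∑ i, Δ i * ∑ t ∈ Finset.range T, P.real {ω | arm t ω = i}
      ≤ ∑ i, Δ i * ((r i + δ) * Real.log T) := Finset.sum_le_sum fun i _ => hT i
    _ = (∑ i, Δ i * r i + δ * ∑ i, Δ i) * Real.log T := by
      rw [Finset.mul_sum, ← Finset.sum_add_distrib, Finset.sum_mul]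
      exact Finset.sum_congr rfl fun i _ => by ring
    _ ≤ b * Real.log T := mul_le_mul_of_nonneg_right (by linarith) hlog

end AdaPort

end

theorem theorem2 {Ω : Type*} [MeasurableSpace Ω] (P : Measure Ω) [IsProbabilityMeasure P]
    {N : ℕ} (α β : Fin N → ℝ) (X Y : ℕ → Ω → Fin N → Bool)
    (θ : ℕ → Ω → Fin N → ℝ) (arm : ℕ → Ω → Fin N)
    (henv : AdaPort.IsEnvironment P α β X Y)
    (halg : AdaPort.IsAdaPort P X Y θ arm)
    (iopt : Fin N) (hopt : ∀ i, α i * β i ≤ α iopt * β iopt) :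
    limsup (fun T : ℕ =>
        ((AdaPort.regret P X Y arm iopt T / Real.log (T : ℝ) : ℝ) : EReal)) atTop ≤
      ((∑ i with i ≠ iopt ∧ α iopt * β iopt < α i,
          (α iopt * β iopt - α i * β i) /
            AdaPort.bernoulliKL (β i) (α iopt * β iopt / α i) : ℝ) : EReal) := by
  -- It suffices to bound the limsup by every real `b` above the sum; in `EReal` no boundedness has
  -- to be checked.
  refine EReal.le_of_forall_lt_iff_le.1 fun b hb => ?_
  refine limsup_le_of_le (by isBoundedDefault) ?_
  filter_upwards [AdaPort.eventually_regret_le henv halg hopt (EReal.coe_lt_coe_iff.1 hb),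
    eventually_gt_atTop 1] with T hT hT1
  exact EReal.coe_le_coe_iff.2 ((div_le_iff₀ (Real.log_pos (by exact_mod_cast hT1))).2 hT)
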